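/- Let $T>0$ and let $(\Omega,\mathcal F,(\mathcal F_t)_{t\in[0,T]},\mathbb P)$ be a complete filtered probability space (every $\mathcal F_t$ contains all $\mathbb P$-null sets). Write $h(A,B)\in[0,\infty]$ for the Hausdorff distance of nonempty sets $A,B\subseteq\mathbb R^d$ (Euclidean norm). Let $C\subseteq\mathbb R^d$ be a nonempty closed convex cone with $C\neq\{0\}$ and $C\neq\mathbb R^d$, and let $$L_C=\{A\subseteq\mathbb R^d:\ A\neq\emptyset \text{ closed},\ A=\overline{A+C},\ h(A,C)<\infty\}.$$ A map $G$ from a measurable space $(X,\mathcal M)$ to the nonempty closed subsets of $\mathbb R^d$ is called measurable if $\{x: G(x)\cap E\neq\emptyset\}\in\mathcal M$ for every closed $E\subseteq\mathbb R^d$. A process on $[0,T]\times\Omega$, with values in $\mathbb R^d$ or set-valued, is called nonanticipative if it is $\mathcal B([0,T])\otimes\mathcal F$-measurable and adapted. For a nonanticipative set-valued process $F$ let $S^2_{\mathbb F}(F)$ be the set of nonanticipative $\varphi\in L^2([0,T]\times\Omega;\mathbb R^d)$ with $\varphi\in F$ $dt\otimes\mathbb P$-a.e. Let $\mathbb L^2_{C,\mathbb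 F}$ be the set of nonanticipative $F$ with nonempty closed values such that $S^2_{\mathbb F}(F)\neq\emptyset$, for each $t\in[0,T]$ one has $F_t\in L_C$ a.s., and $\mathbb E\int_0^T h^2(F_s,C)\,ds<\infty$. For a sub-$\sigma$-algebra $\mathcal G\subseteq\mathcal F$, let $\mathbb L^2_C(\Omega,\mathcal G)$ be the set of $\mathcal G$-measurable maps $G$ from $\Omega$ to the nonempty closed subsets of $\mathbb R^d$ such that $G\in L_C$ a.s. and $\mathbb E[h^2(G,C)]<\infty$. For $t\in(0,T]$, the set-valued Lebesgue integral $\int_0^tF_s\,ds$ is the $\mathcal F_t$-measurable map $I$ from $\Omega$ to the nonempty closed subsets of $\mathbb R^d$ such that the set of all $u\in L^2(\Omega,\mathcal F_t;\mathbb R^d)$ with $u\in I$ a.s. equals the $L^2$-closure of the $\mathcal F_t$-decomposable hull of $\{\int_0^t\varphi_s\,ds:\varphi\in S^2_{\mathbb F}(F)\}$. Here a set $V$ of functions is $\mathcal F_t$-decomposable if $\mathbf 1_Af+\mathbf 1_{A^c}g\in V$ for all $f,g\in V$ and $A\in\mathcal F_t$, and the $\mathcal F_t$-decomposable hull is the smallest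 $\mathcal F_t$-decomposable set containing the given one. For $t=0$ put $\int_0^0F_s\,ds:=C$. **Proposition.** Let $F\in\mathbb L^2_{C,\mathbb F}$. Then for every $t\in(0,T]$ the integral $\int_0^tF_s\,ds$ exists, is unique up to $\mathbb P$-null sets, and belongs to $\mathbb L^2_C(\Omega,\mathcal F_t)$. Moreover, the process $\{\int_0^tF_s\,ds\}_{0\le t\le T}$, each of whose values for $t>0$ is determined up to a null set, has $\mathbb P$-a.s. Hausdorff-continuous paths: for any choice $(X_t)_{0<t\le T}$ of the integrals there is a process $(Y_t)_{0\le t\le T}$ with $Y_0=C$ such that, for every $t\in(0,T]$, $Y_t=X_t$ a.s. and $Y_t$ is again a version of $\int_0^tF_s\,ds$, and such that, for $\mathbb P$-a.e. $\omega$, $h(Y_s(\omega),Y_t(\omega))\to0$ as $s\to t$ in $[0,T]$, for every $t\in[0,T]$. -/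

import Mathlib

open MeasureTheory ProbabilityTheory Filter Topology
open scoped ENNReal Pointwise

noncomputable section

namespace SetInt

/-- The Euclidean space `ℝᵈ`. -/
abbrev Euc (d : ℕ) : Type := EuclideanSpace ℝ (Fin d)

/-- `h²(A, B)`: the squared Hausdorff distance, with values in `[0, ∞]`. -/
def hsq {d : ℕ} (A B : Set (Euc d)) : ℝ≥0∞ := Metric.hausdorffEDist A B ^ 2

/-- The generating cone: a nonempty closed convex cone, different from `{0}` and from the whole
space. -/
structure IsGeneratingCone {d : ℕ} (C : Set (Euc d)) : Prop where
  nonempty : C.Nonempty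
  isClosed : IsClosed C
  convex : Convex ℝ C
  smul_mem : ∀ a : ℝ, 0 < a → ∀ x ∈ C, a • x ∈ C
  ne_zero : C ≠ {0}
  ne_univ : C ≠ Set.univ

/-- The space `L_C`: nonempty closed sets `A` with `A = cl (A + C)` (Minkowski sum) and
`h(A, C) < ∞`. -/
structure MemLC {d : ℕ} (C A : Set (Euc d)) : Prop where
  nonempty : A.Nonempty
  isClosed : IsClosed A
  add_cone : A = closure (A + C)
  hausdorff_lt_top : Metric.hausdorffEDist A C < ∞

/-- A measurable set-valued map `X → 𝒞(ℝᵈ)` with respect to the σ-algebra `m`: its values are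
nonempty and closed, and `{x | G x ∩ E ≠ ∅} ∈ m` for every nonempty closed set `E`
(the case `E = ∅` is trivial). -/
structure SetMeasurable {X : Type*} {d : ℕ} (m : MeasurableSpace X) (G : X → Set (Euc d)) :
    Prop where
  nonempty : ∀ x, (G x).Nonempty
  isClosed : ∀ x, IsClosed (G x)
  measurableSet_hit : ∀ E : Set (Euc d), IsClosed E → MeasurableSet[m] {x | (G x ∩ E).Nonempty}

section Static

variable {Ω : Type*} {mΩ : MeasurableSpace Ω} {d : ℕ}

/-- `𝕃²_𝓜(Ω, ℝᵈ)`: the `𝓜`-measurable square integrable functions (not identified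
a.e.). -/
def L2 (P : Measure Ω) (m : MeasurableSpace Ω) : Set (Ω → Euc d) :=
  {f | Measurable[m] f ∧ MemLp f 2 P}

/-- `S²_𝓜(G)`: the `𝓜`-measurable square integrable a.e. selectors of `G`. -/
def selectors (P : Measure Ω) (m : MeasurableSpace Ω) (G : Ω → Set (Euc d)) :
    Set (Ω → Euc d) :=
  {f | f ∈ L2 P m ∧ ∀ᵐ ω ∂P, f ω ∈ G ω}

/-- A set `V` of functions is `𝓜`-decomposable if `1_A f + 1_{Aᶜ} g ∈ V` for all
`f, g ∈ V` and `A ∈ 𝓜`. -/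
def Decomposable (m : MeasurableSpace Ω) (V : Set (Ω → Euc d)) : Prop :=
  ∀ f ∈ V, ∀ g ∈ V, ∀ A : Set Ω, MeasurableSet[m] A → A.indicator f + Aᶜ.indicator g ∈ V

/-- The decomposable hull: the smallest `𝓜`-decomposable set containing `V`. -/
def dec (m : MeasurableSpace Ω) (V : Set (Ω → Euc d)) : Set (Ω → Euc d) :=
  {f | ∀ W : Set (Ω → Euc d), Decomposable m W → V ⊆ W → f ∈ W}

/-- The closed decomposable hull: the closure of the decomposable hull in
`𝕃²_𝓜(Ω, ℝᵈ)`. -/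
def closedDec (P : Measure Ω) (m : MeasurableSpace Ω) (V : Set (Ω → Euc d)) :
    Set (Ω → Euc d) :=
  {f | f ∈ L2 P m ∧ ∀ ε : ℝ≥0∞, 0 < ε → ∃ g ∈ dec m V, eLpNorm (f - g) 2 P < ε}

/-- `𝕃²_C(Ω, 𝓜)`: the `𝓜`-measurable set-valued maps `G` with `G ∈ L_C` almost surely and
`𝔼[h²(G, C)] < ∞`. -/
structure MemL2C (P : Measure Ω) (m : MeasurableSpace Ω) (C : Set (Euc d))
    (G : Ω → Set (Euc d)) : Prop where
  measurable : SetMeasurable m G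
  memLC : ∀ᵐ ω ∂P, MemLC C (G ω)
  sq_integrable : ∫⁻ ω, hsq (G ω) C ∂P < ∞

end Static

section Dynamic

/-- Lebesgue measure on `[0, T]`. -/
def timeMeasure (T : ℝ) : Measure (Set.Icc (0 : ℝ) T) :=
  Measure.comap Subtype.val volume

variable {Ω : Type*} {mΩ : MeasurableSpace Ω} {d : ℕ} {T : ℝ}

/-- The filtration is complete: every `𝓕_t` contains all `P`-null sets (`P` is extended to an
outer measure on all subsets, so in particular the probability space is complete). -/
def CompleteFiltration (P : Measure Ω) (ℱ : Filtration (Set.Icc (0 : ℝ) T) mΩ) : Prop :=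
  ∀ t, ∀ N : Set Ω, P N = 0 → MeasurableSet[ℱ t] N

/-- Non-anticipative `ℝᵈ`-valued processes: jointly measurable and adapted. -/
def NonAnticipative (ℱ : Filtration (Set.Icc (0 : ℝ) T) mΩ)
    (φ : Set.Icc (0 : ℝ) T → Ω → Euc d) : Prop :=
  Measurable (fun p : Set.Icc (0 : ℝ) T × Ω => φ p.1 p.2) ∧ ∀ t, Measurable[ℱ t] (φ t)

/-- Non-anticipative set-valued processes with nonempty closed values. -/
def SetNonAnticipative (ℱ : Filtration (Set.Icc (0 : ℝ) T) mΩ)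
    (F : Set.Icc (0 : ℝ) T → Ω → Set (Euc d)) : Prop :=
  SetMeasurable inferInstance (fun p : Set.Icc (0 : ℝ) T × Ω => F p.1 p.2) ∧
    ∀ t, SetMeasurable (ℱ t) (F t)

/-- `S²_𝔽(F)`: the non-anticipative `dt ⊗ dP`-square integrable selectors of `F`. -/
def processSelectors (P : Measure Ω) (ℱ : Filtration (Set.Icc (0 : ℝ) T) mΩ)
    (F : Set.Icc (0 : ℝ) T → Ω → Set (Euc d)) : Set (Set.Icc (0 : ℝ) T → Ω → Euc d) :=
  {φ | NonAnticipative ℱ φ ∧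
    MemLp (fun p : Set.Icc (0 : ℝ) T × Ω => φ p.1 p.2) 2 ((timeMeasure T).prod P) ∧
    ∀ᵐ p ∂((timeMeasure T).prod P), φ p.1 p.2 ∈ F p.1 p.2}

/-- `𝕃²_{C,𝔽}([0, T] × Ω; ℝᵈ)`: the non-anticipative set-valued processes that have a
non-anticipative square integrable selector, take values in `L_C` almost surely for every `t`,
and satisfy `𝔼 ∫₀ᵀ h²(F_s, C) ds < ∞`. -/
structure MemL2CF (P : Measure Ω) (ℱ : Filtration (Set.Icc (0 : ℝ) T) mΩ) (C : Set (Euc d))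
    (F : Set.Icc (0 : ℝ) T → Ω → Set (Euc d)) : Prop where
  nonAnticipative : SetNonAnticipative ℱ F
  selectors_nonempty : (processSelectors P ℱ F).Nonempty
  memLC : ∀ t, ∀ᵐ ω ∂P, MemLC C (F t ω)
  sq_integrable : ∫⁻ ω, ∫⁻ s, hsq (F s ω) C ∂(timeMeasure T) ∂P < ∞

/-- `J_{0,t}(F) = {∫₀ᵗ φ_s ds : φ ∈ S²_𝔽(F)}`. -/
def integralsOfSelectors (P : Measure Ω) (ℱ : Filtration (Set.Icc (0 : ℝ) T) mΩ)
    (F : Set.Icc (0 : ℝ) T → Ω → Set (Euc d)) (t : Set.Icc (0 : ℝ) T) : Set (Ω → Euc d) :=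
  {u | ∃ φ ∈ processSelectors P ℱ F,
    u = fun ω => ∫ s in Set.Iic t, φ s ω ∂(timeMeasure T)}

/-- `I` is (a version of) the set-valued Lebesgue integral `∫₀ᵗ F_s ds`: an
`𝓕_t`-measurable set-valued map whose set of square integrable `𝓕_t`-measurable selectors is
the closed `𝓕_t`-decomposable hull of `J_{0,t}(F)`. -/
def IsSetIntegral (P : Measure Ω) (ℱ : Filtration (Set.Icc (0 : ℝ) T) mΩ)
    (F : Set.Icc (0 : ℝ) T → Ω → Set (Euc d)) (t : Set.Icc (0 : ℝ) T)
    (I : Ω → Set (Euc d)) : Prop :=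
  SetMeasurable (ℱ t) I ∧
    selectors P (ℱ t) I = closedDec P (ℱ t) (integralsOfSelectors P ℱ F t)

/-- Continuity of a path of sets with respect to the Hausdorff distance. -/
def HausdorffContinuous (x : Set.Icc (0 : ℝ) T → Set (Euc d)) : Prop :=
  ∀ t, Tendsto (fun s => Metric.hausdorffEDist (x s) (x t)) (𝓝 t) (𝓝 0)

end Dynamic

end SetInt

end

/-! Everything rests on one estimate: for `s ≤ t`, almost surely h(X_s, X_t) ≤ ∫ₛᵗ h(F_r, C) dr,
where X_0 = C (`IsIntegralVersion.ae_hausdorffEDist_le`).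

Existence and uniqueness are the Hiai–Umegaki correspondence. A decomposable hull has a pointwise
dense sequence, and the closure of its range is the integral. Conversely, a measurable closed-valued
map with a square integrable selector is recovered a.s. from such selectors by a Castaing
representation. Integrals of selectors are 𝓕_t-measurable because each equals its conditional
expectation a.s. and 𝓕_t is complete.

For the estimate, closed pointwise constraints need only be checked on integrals of selectors. Given
∫₀ᵗ φ = a + b, split at s, the set a + C lies in X_s, so the distance to X_s is at most that of b to
C, and Jensen's inequality for a closed convex cone bounds it. Given ∫₀ˢ φ, continue φ after s by a
selection of F almost nearest to 0; the added integral is at most ∫ₛᵗ h(F_r, C) dr up to ε. At s =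
0, with c ∈ C in place of an integral, the point approximated by the selection is c/t.

Taking s = 0 and applying Cauchy–Schwarz gives membership in 𝕃²_C. Absolute continuity of the
pathwise integral gives a uniform modulus on a countable dense set of times; completeness of the
closed sets under h then yields the continuous modification. -/

namespace SetInt

/-! ### Measurable selections of closed-valued maps -/

section Selection

variable {X : Type*} {m : MeasurableSpace X} {d : ℕ} {G : X → Set (Euc d)}

theorem SetMeasurable.measurableSet_hit_open (hG : SetMeasurable m G) {U : Set (Euc d)}
    (hU : IsOpen U) : MeasurableSet[m] {x | (G x ∩ U).Nonempty} := by
  obtain ⟨F, hF, -, hFU, -⟩ := hU.exists_iUnion_isClosed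
  have : {x | (G x ∩ U).Nonempty} = ⋃ n, {x | (G x ∩ F n).Nonempty} := by
    ext x
    simp only [← hFU, Set.inter_iUnion, Set.nonempty_iUnion, Set.mem_ofPred_eq, Set.mem_iUnion]
  rw [this]
  exact MeasurableSet.iUnion fun n => hG.measurableSet_hit _ (hF n)

/-- For a fixed point, a sublevel set of the distance is the event that `G` hits an open ball. The
distance is also continuous in the point, which allows a measurable point to be substituted. -/
theorem SetMeasurable.measurable_infEDist (hG : SetMeasurable m G) {f : X → Euc d}
    (hf : Measurable f) : Measurable fun x => Metric.infEDist (f x) (G x) := by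
  have hconst : ∀ y : Euc d, Measurable fun x => Metric.infEDist y (G x) := by
    intro y
    refine measurable_of_Iio fun r => ?_
    convert hG.measurableSet_hit_open (Metric.isOpen_eball (x := y) (ε := r)) using 1
    ext x
    simp only [Set.mem_preimage, Set.mem_Iio, Metric.infEDist_lt_iff, Set.mem_ofPred_eq,
      Set.Nonempty, Set.mem_inter_iff, Metric.mem_eball, edist_comm]
  have := measurable_uncurry_of_continuous_of_measurable
    (u := fun (y : Euc d) x => Metric.infEDist y (G x))
    (fun x => Metric.continuous_infEDist) hconst
  exact this.comp (hf.prodMk measurable_id)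

theorem SetMeasurable.measurable_infDist (hG : SetMeasurable m G) {f : X → Euc d}
    (hf : Measurable f) : Measurable fun x => Metric.infDist (f x) (G x) :=
  (hG.measurable_infEDist hf).ennreal_toReal

/-- One refinement step of the selection iteration: choosing the first admissible point of a dense
sequence is measurable. -/
theorem SetMeasurable.exists_measurable_closer (hG : SetMeasurable m G) {f : X → Euc d}
    (hf : Measurable f) {r : X → ℝ} (hr : Measurable r)
    (hfr : ∀ x, Metric.infDist (f x) (G x) < r x) {ε : ℝ} (hε : 0 < ε) :
    ∃ g : X → Euc d, Measurable g ∧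
      ∀ x, Metric.infDist (g x) (G x) < ε ∧ dist (f x) (g x) < r x + ε := by
  classical
  let e := TopologicalSpace.denseSeq (Euc d)
  let p : ℕ → X → Prop := fun n x =>
    Metric.infDist (e n) (G x) < ε ∧ dist (f x) (e n) < r x + ε
  have hp : ∀ n, MeasurableSet {x | p n x} := fun n =>
    (measurableSet_lt (hG.measurable_infDist measurable_const) measurable_const).inter
      (measurableSet_lt (hf.dist measurable_const) (hr.add_const ε))
  have hex : ∀ x, ∃ n, p n x := by
    intro x
    obtain ⟨y, hy, hxy⟩ := (Metric.infDist_lt_iff (hG.nonempty x)).1 (hfr x)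
    obtain ⟨n, hn⟩ := (TopologicalSpace.denseRange_denseSeq (Euc d)).exists_dist_lt y hε
    refine ⟨n, (Metric.infDist_le_dist_of_mem hy).trans_lt ?_, ?_⟩
    · rwa [dist_comm]
    · exact (dist_triangle _ y _).trans_lt (add_lt_add hxy hn)
  exact ⟨fun x => e (Nat.find (hex x)), Measurable.find (fun n => measurable_const) hp hex,
    fun x => Nat.find_spec (hex x)⟩

/-- Measurable selection (Kuratowski and Ryll-Nardzewski), almost nearest to a given map. -/
theorem SetMeasurable.exists_measurable_selection (hG : SetMeasurable m G) {f : X → Euc d}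
    (hf : Measurable f) {ε : ℝ} (hε : 0 < ε) :
    ∃ u : X → Euc d, Measurable u ∧ (∀ x, u x ∈ G x) ∧
      ∀ x, dist (f x) (u x) ≤ Metric.infDist (f x) (G x) + ε := by
  -- Error budget: the start costs ε/8 + δ 0 = ε/4. Step n costs δ n + δ (n+1) ≤ (ε/4)/2ⁿ, so all
  -- later moves cost at most ε/2.
  set δ : ℕ → ℝ := fun n => ε / 8 / 2 ^ n with hδ
  have hδpos : ∀ n, 0 < δ n := fun n => by positivity
  let S (n : ℕ) := {g : X → Euc d // Measurable g ∧ ∀ x, Metric.infDist (g x) (G x) < δ n}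
  obtain ⟨g₀, hg₀, hg₀'⟩ := hG.exists_measurable_closer hf
    ((hG.measurable_infDist hf).add_const (ε / 8)) (fun x => by simp; positivity) (hδpos 0)
  have step : ∀ n (g : S n), ∃ g' : S (n + 1), ∀ x, dist (g.1 x) (g'.1 x) < δ n + δ (n + 1) := by
    rintro n ⟨g, hg, hg'⟩
    obtain ⟨k, hk, hk'⟩ := hG.exists_measurable_closer hg (r := fun _ => δ n) measurable_const hg'
      (hδpos (n + 1))
    exact ⟨⟨k, hk, fun x => (hk' x).1⟩, fun x => (hk' x).2⟩
  choose nxt hnxt using step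
  let s : ∀ n, S n := fun n => Nat.rec ⟨g₀, hg₀, fun x => (hg₀' x).1⟩ (fun n g => nxt n g) n
  have hs : ∀ n x, dist ((s n).1 x) ((s (n + 1)).1 x) ≤ ε / 2 / 2 / 2 ^ n := by
    intro n x
    refine (hnxt n (s n) x).le.trans ?_
    simp only [hδ, pow_succ]
    have : (0 : ℝ) < 2 ^ n := by positivity
    field_simp
    norm_num
  have hlim : ∀ x, ∃ a, Tendsto (fun n => (s n).1 x) atTop (𝓝 a) := fun x =>
    cauchySeq_tendsto_of_complete (cauchySeq_of_le_geometric_two (hs · x))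
  choose u hu using hlim
  refine ⟨u, measurable_of_tendsto_metrizable (fun n => (s n).2.1) (tendsto_pi_nhds.2 hu),
    fun x => ?_, fun x => ?_⟩
  · rw [(hG.isClosed x).mem_iff_infDist_zero (hG.nonempty x)]
    refine tendsto_nhds_unique
      (((Metric.continuous_infDist_pt (G x)).tendsto (u x)).comp (hu x)) ?_
    refine squeeze_zero (fun n => Metric.infDist_nonneg) (fun n => ((s n).2.2 x).le) ?_
    have := (tendsto_pow_atTop_nhds_zero_of_lt_one (r := (1 / 2 : ℝ)) (by norm_num)
      (by norm_num)).const_mul (ε / 8)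
    simpa [hδ, div_eq_mul_inv] using this
  · have h1 := dist_le_of_le_geometric_two_of_tendsto₀ (hs · x) (hu x)
    have h2 : dist (f x) ((s 0).1 x) < Metric.infDist (f x) (G x) + ε / 8 + δ 0 := (hg₀' x).2
    have h3 : δ 0 = ε / 8 := by simp [hδ]
    have h4 := dist_triangle (f x) ((s 0).1 x) (u x)
    linarith

/-- Castaing representation. -/
theorem SetMeasurable.exists_castaing (hG : SetMeasurable m G) :
    ∃ u : ℕ → X → Euc d, (∀ n, Measurable (u n)) ∧
      ∀ x, G x = closure (Set.range fun n => u n x) := by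
  let e := TopologicalSpace.denseSeq (Euc d)
  have h : ∀ p : ℕ × ℕ, ∃ u : X → Euc d, Measurable u ∧ (∀ x, u x ∈ G x) ∧
      ∀ x, dist (e p.1) (u x) ≤ Metric.infDist (e p.1) (G x) + 1 / ((p.2 : ℝ) + 1) := fun p =>
    hG.exists_measurable_selection measurable_const (by positivity)
  choose u hu huG hud using h
  refine ⟨fun n => u (Nat.unpair n), fun n => hu _, fun x => subset_antisymm ?_ ?_⟩
  · intro y hy
    refine Metric.mem_closure_iff.2 fun ε hε => ?_
    obtain ⟨k, hk⟩ := exists_nat_one_div_lt (show 0 < ε / 3 by positivity)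
    obtain ⟨n, hn⟩ := (TopologicalSpace.denseRange_denseSeq (Euc d)).exists_dist_lt y
      (show 0 < ε / 3 by positivity)
    refine ⟨u (n, k) x, ⟨Nat.pair n k, by simp⟩, ?_⟩
    have h1 := hud (n, k) x
    have h2 : Metric.infDist (e n) (G x) ≤ dist (e n) y := Metric.infDist_le_dist_of_mem hy
    have h3 := dist_triangle y (e n) (u (n, k) x)
    have h4 : dist y (e n) < ε / 3 := hn
    rw [dist_comm] at h2
    simp only at h1
    linarith
  · exact closure_minimal (by rintro _ ⟨n, rfl⟩; exact huG _ x) (hG.isClosed x)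

/-- Converse of the Castaing representation. By compactness of E ∩ closedBall 0 N, the closure meets
that piece iff some `u n` comes arbitrarily close to it, which is a countable condition. -/
theorem setMeasurable_closure_range {u : ℕ → X → Euc d} (hu : ∀ n, Measurable (u n)) :
    SetMeasurable m fun x => closure (Set.range fun n => u n x) := by
  refine ⟨fun x => (Set.range_nonempty _).closure, fun x => isClosed_closure, fun E hE => ?_⟩
  have key : {x | (closure (Set.range fun n => u n x) ∩ E).Nonempty} =
      ⋃ N : ℕ, ⋂ k : ℕ, ⋃ n : ℕ,
        {x | Metric.infEDist (u n x) (E ∩ Metric.closedBall 0 N) < ((k : ℝ≥0∞) + 1)⁻¹} := by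
    ext x
    simp only [Set.mem_ofPred_eq, Set.mem_iUnion, Set.mem_iInter]
    constructor
    · rintro ⟨y, hy, hyE⟩
      obtain ⟨N, hN⟩ := exists_nat_ge (dist y 0)
      refine ⟨N, fun k => ?_⟩
      obtain ⟨_, ⟨n, rfl⟩, hn⟩ := EMetric.mem_closure_iff.1 hy ((k : ℝ≥0∞) + 1)⁻¹ (by simp)
      have hyN : y ∈ E ∩ Metric.closedBall 0 (N : ℝ) := ⟨hyE, hN⟩
      exact ⟨n, (Metric.infEDist_le_edist_of_mem hyN).trans_lt (by rwa [edist_comm])⟩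
    · rintro ⟨N, hN⟩
      simp only [Metric.infEDist_lt_iff] at hN
      choose n y hy hny using hN
      have hK : IsCompact (E ∩ Metric.closedBall (0 : Euc d) N) :=
        (isCompact_closedBall 0 (N : ℝ)).inter_left hE
      obtain ⟨a, ha, φ, hφ, hlim⟩ := hK.tendsto_subseq hy
      refine ⟨a, ?_, ha.1⟩
      refine mem_closure_of_tendsto (f := fun k => u (n (φ k)) x) (b := atTop) ?_
        (Eventually.of_forall fun k => ⟨_, rfl⟩)
      rw [tendsto_iff_edist_tendsto_0] at hlim ⊢
      have h0 : Tendsto (fun k => ((φ k : ℝ≥0∞) + 1)⁻¹) atTop (𝓝 0) := by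
        have := ENNReal.tendsto_inv_nat_nhds_zero.comp
          ((tendsto_add_atTop_nat 1).comp hφ.tendsto_atTop)
        simpa [Function.comp_def] using this
      refine tendsto_of_tendsto_of_tendsto_of_le_of_le tendsto_const_nhds
        (by simpa using h0.add hlim) (fun _ => zero_le) fun k => ?_
      exact (edist_triangle _ (y (φ k)) _).trans (add_le_add (hny _).le le_rfl)
  rw [key]
  refine MeasurableSet.iUnion fun N => MeasurableSet.iInter fun k => MeasurableSet.iUnion
    fun n => ?_
  exact measurableSet_lt (Metric.continuous_infEDist.measurable.comp (hu n)) measurable_const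

/-- The excess of `G x` over `C` exceeds r iff `G x` hits an open set. The opposite excess is a
supremum over a countable dense subset of `C`. -/
theorem SetMeasurable.measurable_hausdorffEDist (hG : SetMeasurable m G) (C : Set (Euc d)) :
    Measurable fun x => Metric.hausdorffEDist (G x) C := by
  simp only [Metric.hausdorffEDist_def]
  refine Measurable.sup ?_ ?_
  · refine measurable_of_Ioi fun r => ?_
    convert hG.measurableSet_hit_open
      (isOpen_Ioi.preimage (Metric.continuous_infEDist (s := C)) (t := Set.Ioi r)) using 1
    ext x
    simp only [Set.mem_preimage, Set.mem_Ioi, lt_iSup_iff, Set.mem_ofPred_eq, Set.Nonempty,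
      Set.mem_inter_iff, exists_prop]
  · obtain ⟨D, hDC, hD, hCD⟩ := TopologicalSpace.IsSeparable.exists_countable_dense_subset
      (TopologicalSpace.IsSeparable.of_separableSpace C)
    have : (fun x => ⨆ y ∈ C, Metric.infEDist y (G x)) =
        fun x => ⨆ y ∈ D, Metric.infEDist y (G x) := by
      ext x
      refine le_antisymm (iSup₂_le fun y hy => ?_) (biSup_mono fun y hy => hDC hy)
      have hcl : IsClosed {y | Metric.infEDist y (G x) ≤ ⨆ y ∈ D, Metric.infEDist y (G x)} :=
        isClosed_le Metric.continuous_infEDist continuous_const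
      exact closure_minimal (fun z hz => le_iSup₂ (f := fun y _ => Metric.infEDist y (G x)) z hz)
        hcl (hCD hy)
    rw [this]
    exact Measurable.biSup D hD fun y _ => hG.measurable_infEDist measurable_const

end Selection

/-! ### Comparison sets, for a single σ-algebra -/

section MeasurableComparison

variable {X : Type*} {m : MeasurableSpace X} {d : ℕ} {f g h k : X → Euc d}

theorem measurableSet_norm_le (hf : Measurable f) (r : ℝ) : MeasurableSet {x | ‖f x‖ ≤ r} :=
  measurableSet_le hf.norm measurable_const

theorem measurableSet_dist_lt (hf : Measurable f) (hg : Measurable g) (r : ℝ) :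
    MeasurableSet {x | dist (f x) (g x) < r} :=
  measurableSet_lt (hf.dist hg) measurable_const

theorem measurableSet_edist_lt_edist (hf : Measurable f) (hg : Measurable g) (q : Euc d) :
    MeasurableSet {x | edist (f x) q < edist (g x) q} :=
  measurableSet_lt (hf.edist measurable_const) (hg.edist measurable_const)

end MeasurableComparison

/-! ### Decomposable hulls and their representation by set-valued maps -/

section Decomposability

variable {Ω : Type*} {d : ℕ} {m mΩ : MeasurableSpace Ω} {P : Measure Ω} {V W : Set (Ω → Euc d)}

theorem subset_dec (m : MeasurableSpace Ω) (V : Set (Ω → Euc d)) : V ⊆ dec m V :=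
  fun _ hv _ _ hVW => hVW hv

theorem decomposable_dec (m : MeasurableSpace Ω) (V : Set (Ω → Euc d)) :
    Decomposable m (dec m V) :=
  fun f hf g hg A hA W hW hVW => hW f (hf W hW hVW) g (hg W hW hVW) A hA

theorem dec_subset (hW : Decomposable m W) (hVW : V ⊆ W) : dec m V ⊆ W :=
  fun _ hf => hf W hW hVW

theorem indicator_add_indicator_compl_apply (A : Set Ω) [DecidablePred (· ∈ A)]
    (f g : Ω → Euc d) (ω : Ω) :
    (A.indicator f + Aᶜ.indicator g) ω = if ω ∈ A then f ω else g ω := by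
  by_cases h : ω ∈ A <;> simp [h]

theorem decomposable_L2 (hm : m ≤ mΩ) : Decomposable m (L2 (d := d) P m) := by
  rintro f ⟨hf, hf2⟩ g ⟨hg, hg2⟩ A hA
  exact ⟨Measurable.add (hf.indicator hA) (hg.indicator hA.compl),
    (hf2.indicator (hm _ hA)).add (hg2.indicator (hm _ hA.compl))⟩

theorem decomposable_ae_mem (Z : Ω → Set (Euc d)) :
    Decomposable m {f | ∀ᵐ ω ∂P, f ω ∈ Z ω} := by
  classical
  intro f hf g hg A _
  change ∀ᵐ ω ∂P, _
  filter_upwards [show ∀ᵐ ω ∂P, f ω ∈ Z ω from hf, show ∀ᵐ ω ∂P, g ω ∈ Z ω from hg] with ω h1 h2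
  rw [indicator_add_indicator_compl_apply]
  split_ifs
  exacts [h1, h2]

theorem dec_subset_L2 (hm : m ≤ mΩ) (hV : V ⊆ L2 P m) : dec m V ⊆ L2 P m :=
  dec_subset (decomposable_L2 hm) hV

theorem dec_subset_closedDec (hm : m ≤ mΩ) (hV : V ⊆ L2 P m) : dec m V ⊆ closedDec P m V :=
  fun f hf => ⟨dec_subset_L2 hm hV hf, fun ε hε => ⟨f, hf, by simpa using hε⟩⟩

/-- A pointwise closed constraint that holds on `V` holds on the closed decomposable hull. -/
theorem ae_mem_of_mem_closedDec (hm : m ≤ mΩ) (hV : V ⊆ L2 P m) {Z : Ω → Set (Euc d)}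
    (hZ : ∀ᵐ ω ∂P, IsClosed (Z ω)) (hVZ : ∀ v ∈ V, ∀ᵐ ω ∂P, v ω ∈ Z ω) {u : Ω → Euc d}
    (hu : u ∈ closedDec P m V) : ∀ᵐ ω ∂P, u ω ∈ Z ω := by
  have hdec : ∀ v ∈ dec m V, ∀ᵐ ω ∂P, v ω ∈ Z ω := dec_subset (decomposable_ae_mem Z) hVZ
  have hseq : ∀ n : ℕ, ∃ g ∈ dec m V, eLpNorm (u - g) 2 P < ((n : ℝ≥0∞) + 1)⁻¹ := fun n =>
    hu.2 _ (by simp)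
  choose g hg hgu using hseq
  have hlim : Tendsto (fun n => eLpNorm (g n - u) 2 P) atTop (𝓝 0) := by
    have h0 : Tendsto (fun n : ℕ => ((n : ℝ≥0∞) + 1)⁻¹) atTop (𝓝 0) := by
      have := ENNReal.tendsto_inv_nat_nhds_zero.comp (tendsto_add_atTop_nat 1)
      simpa [Function.comp_def] using this
    refine tendsto_of_tendsto_of_tendsto_of_le_of_le tendsto_const_nhds h0
      (fun _ => zero_le) fun n => ?_
    rw [eLpNorm_sub_comm]
    exact (hgu n).le
  obtain ⟨ns, -, hns⟩ := (tendstoInMeasure_of_tendsto_eLpNorm (by norm_num)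
    (fun n => (dec_subset_L2 hm hV (hg n)).2.1) hu.1.2.1 hlim).exists_seq_tendsto_ae
  filter_upwards [hns, hZ, ae_all_iff.2 fun n => hdec _ (hg n)] with ω h1 h2 h3
  exact h2.mem_of_tendsto h1 (Eventually.of_forall fun k => h3 _)

/-- Castaing representation by square integrable selectors. -/
theorem SetMeasurable.exists_castaing_selectors [IsFiniteMeasure P] (hm : m ≤ mΩ)
    {G : Ω → Set (Euc d)} (hG : SetMeasurable m G) {f : Ω → Euc d} (hf : f ∈ selectors P m G) :
    ∃ u : ℕ → Ω → Euc d, (∀ n, u n ∈ selectors P m G) ∧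
      ∀ᵐ ω ∂P, G ω = closure (Set.range fun n => u n ω) := by
  classical
  obtain ⟨v, hv, hGv⟩ := hG.exists_castaing
  have hvG : ∀ n ω, v n ω ∈ G ω := fun n ω => by rw [hGv ω]; exact subset_closure ⟨n, rfl⟩
  let A : ℕ → ℕ → Set Ω := fun n N => {ω | ‖v n ω‖ ≤ N}
  have hA : ∀ n N, MeasurableSet[m] (A n N) := fun n N => measurableSet_norm_le (hv n) N
  -- Truncation gives square integrability: follow `v n` where its norm is at most N, and the given
  -- selector elsewhere. At each ω the value `v n ω` is attained once N is large.
  let u : ℕ × ℕ → Ω → Euc d := fun p => (A p.1 p.2).indicator (v p.1) + (A p.1 p.2)ᶜ.indicator f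
  have hu : ∀ p, u p ∈ selectors P m G := by
    intro p
    refine ⟨⟨?_, ?_⟩, ?_⟩
    · exact Measurable.add ((hv p.1).indicator (hA _ _)) (hf.1.1.indicator (hA _ _).compl)
    · refine MemLp.add ?_ (hf.1.2.indicator (hm _ (hA _ _).compl))
      refine MemLp.of_bound
        (((hv p.1).indicator (hA _ _)).mono hm le_rfl).aestronglyMeasurable p.2 ?_
      refine Eventually.of_forall fun ω => ?_
      by_cases h : ω ∈ A p.1 p.2
      · have h' : ‖v p.1 ω‖ ≤ p.2 := h
        simpa [h] using h'
      · simp [h]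
    · have hv' : ∀ᵐ ω ∂P, v p.1 ω ∈ G ω := Eventually.of_forall (hvG p.1)
      exact decomposable_ae_mem (m := m) (P := P) G (v p.1) hv' f hf.2 _ (hA p.1 p.2)
  refine ⟨fun n => u n.unpair, fun n => hu _, ?_⟩
  filter_upwards [ae_all_iff.2 fun p => (hu p).2] with ω hω
  refine subset_antisymm ?_ ((hG.isClosed ω).closure_subset_iff.2 ?_)
  · rw [hGv ω]
    refine closure_mono ?_
    rintro _ ⟨n, rfl⟩
    obtain ⟨N, hN⟩ := exists_nat_ge ‖v n ω‖
    refine ⟨Nat.pair n N, ?_⟩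
    have : ω ∈ A n N := hN
    simp [u, this]
  · rintro _ ⟨n, rfl⟩
    exact hω _

/-- Glue finitely many `f k` so that the result is δ-close to `u` off a set `B N` and equals `f 0`
on it. `B N` decreases to a null set, so the tail of u - f 0 there is small in L². -/
theorem mem_closedDec_of_ae_mem_closure [IsFiniteMeasure P] (hm : m ≤ mΩ) (hV : V ⊆ L2 P m)
    {f : ℕ → Ω → Euc d} (hf : ∀ n, f n ∈ dec m V) {u : Ω → Euc d} (hu : u ∈ L2 P m)
    (huf : ∀ᵐ ω ∂P, u ω ∈ closure (Set.range fun n => f n ω)) : u ∈ closedDec P m V := by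
  classical
  refine ⟨hu, fun ε hε => ?_⟩
  have hfL : ∀ n, f n ∈ L2 P m := fun n => dec_subset_L2 hm hV (hf n)
  obtain ⟨δ, hδ, hδε⟩ : ∃ δ : ℝ, 0 < δ ∧
      ENNReal.ofReal δ + ENNReal.ofReal δ * P Set.univ ^ (1 / (2 : ℝ)) < ε := by
    have hc : Tendsto (fun δ : ℝ => ENNReal.ofReal δ +
        ENNReal.ofReal δ * P Set.univ ^ (1 / (2 : ℝ))) (𝓝[>] 0) (𝓝 0) := by
      have h1 : Tendsto (fun δ : ℝ => ENNReal.ofReal δ) (𝓝[>] 0) (𝓝 0) := by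
        have := (ENNReal.continuous_ofReal.tendsto 0).mono_left
          (nhdsWithin_le_nhds (s := Set.Ioi 0))
        simpa using this
      have h2 := ENNReal.Tendsto.mul_const (b := P Set.univ ^ (1 / (2 : ℝ))) h1
        (Or.inr (ENNReal.rpow_ne_top_of_nonneg (by norm_num) (measure_ne_top _ _)))
      simpa using h1.add h2
    obtain ⟨δ, h1, h2⟩ := ((hc.eventually (gt_mem_nhds hε)).and self_mem_nhdsWithin).exists
    exact ⟨δ, h2, h1⟩
  let A : ℕ → Set Ω := fun n => {ω | dist (u ω) (f n ω) < δ}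
  have hA : ∀ n, MeasurableSet[m] (A n) := fun n =>
    measurableSet_dist_lt hu.1 (hfL n).1 δ
  -- The largest k < N with `f k ω` within δ of `u ω` is used; `f 0` is the default.
  let g : ℕ → Ω → Euc d := fun N =>
    Nat.rec (f 0) (fun n h => (A n).indicator (f n) + (A n)ᶜ.indicator h) N
  have hg : ∀ N, g N ∈ dec m V := by
    intro N
    induction N with
    | zero => exact hf 0
    | succ N ih => exact decomposable_dec m V _ (hf N) _ ih _ (hA N)
  let B : ℕ → Set Ω := fun N => (⋃ k, ⋃ _ : k < N, A k)ᶜ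
  have hB : ∀ N, MeasurableSet[m] (B N) := fun N =>
    (MeasurableSet.iUnion fun k => MeasurableSet.iUnion fun _ => hA k).compl
  have hgB : ∀ N ω, ‖(u - g N) ω‖ ≤ δ + ‖(B N).indicator (u - f 0) ω‖ := by
    intro N ω
    by_cases hω : ω ∈ B N
    · have : g N ω = f 0 ω := by
        induction N with
        | zero => rfl
        | succ N ih =>
          have hω' : (ω ∉ A N) ∧ ω ∈ B N := by
            simp only [B, Set.mem_compl_iff, Set.mem_iUnion, not_exists] at hω ⊢
            exact ⟨hω N N.lt_succ_self, fun k hk => hω k (hk.trans N.lt_succ_self)⟩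
          change ((A N).indicator (f N) + (A N)ᶜ.indicator (g N)) ω = _
          rw [indicator_add_indicator_compl_apply, if_neg hω'.1, ih hω'.2]
      simp only [Set.indicator_of_mem hω, Pi.sub_apply, this]
      linarith
    · refine le_trans ?_ (le_add_of_nonneg_right (norm_nonneg _))
      induction N with
      | zero => simp [B] at hω
      | succ N ih =>
        change ‖u ω - ((A N).indicator (f N) + (A N)ᶜ.indicator (g N)) ω‖ ≤ δ
        rw [indicator_add_indicator_compl_apply]
        split_ifs with h
        · rw [← dist_eq_norm]
          exact le_of_lt h
        · refine ih ?_
          simp only [B, Set.mem_compl_iff, not_not, Set.mem_iUnion] at hω ⊢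
          obtain ⟨k, hk, hkω⟩ := hω
          refine ⟨k, (Nat.lt_succ_iff.1 hk).lt_of_ne ?_, hkω⟩
          rintro rfl
          exact h hkω
  obtain ⟨η, hη, hηδ⟩ := MemLp.eLpNorm_indicator_le (p := 2) (by norm_num) (by norm_num)
    (hu.2.sub (hfL 0).2) hδ
  have hBlim : Tendsto (fun N => P (B N)) atTop (𝓝 0) := by
    have hanti : Antitone B := fun N M hNM => Set.compl_subset_compl.2
      (Set.iUnion_mono fun k => Set.iUnion_mono' fun hk => ⟨hk.trans_le hNM, le_rfl⟩)
    have := tendsto_measure_iInter_atTop (μ := P)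
      (fun N => (hm _ (hB N)).nullMeasurableSet) hanti ⟨0, measure_ne_top _ _⟩
    have h0 : P (⋂ N, B N) = 0 := by
      refine measure_mono_null ?_ huf
      intro ω hω hmem
      obtain ⟨_, ⟨n, rfl⟩, hn⟩ := Metric.mem_closure_iff.1 hmem δ hδ
      have h1 : ω ∈ B (n + 1) := Set.mem_iInter.1 hω (n + 1)
      simp only [B, Set.mem_compl_iff, Set.mem_iUnion, not_exists] at h1
      exact h1 n n.lt_succ_self hn
    rwa [h0] at this
  obtain ⟨N, hN⟩ := (hBlim.eventually (gt_mem_nhds (ENNReal.ofReal_pos.2 hη))).exists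
  refine ⟨g N, hg N, lt_of_le_of_lt ?_ hδε⟩
  have hmeas : AEStronglyMeasurable ((B N).indicator (u - f 0)) P :=
    ((hu.2.sub (hfL 0).2).indicator (hm _ (hB N))).1
  calc eLpNorm (u - g N) 2 P
      ≤ eLpNorm (fun ω => δ + ‖(B N).indicator (u - f 0) ω‖) 2 P :=
        eLpNorm_mono_real (hgB N)
    _ ≤ eLpNorm (fun _ => δ) 2 P + eLpNorm (fun ω => ‖(B N).indicator (u - f 0) ω‖) 2 P :=
        eLpNorm_add_le aestronglyMeasurable_const hmeas.norm (by norm_num)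
    _ ≤ ENNReal.ofReal δ * P Set.univ ^ (1 / (2 : ℝ)) + ENNReal.ofReal δ := by
        rw [eLpNorm_norm]
        refine add_le_add ?_ (hηδ _ (hm _ (hB N)) hN.le)
        rw [eLpNorm_const' _ (by norm_num) (by norm_num), Real.enorm_of_nonneg hδ.le]
        norm_num
    _ = _ := add_comm _ _

/-- A nonempty decomposable set has a countable subset that is pointwise dense in it. -/
theorem Decomposable.exists_seq_dense [IsFiniteMeasure P] (hm : m ≤ mΩ) (hW : Decomposable m W)
    (hne : W.Nonempty) (hmeas : ∀ f ∈ W, Measurable[m] f) :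
    ∃ f : ℕ → Ω → Euc d, (∀ n, f n ∈ W) ∧
      ∀ g ∈ W, ∀ᵐ ω ∂P, g ω ∈ closure (Set.range fun n => f n ω) := by
  classical
  -- The truncation at 1 keeps the integrals finite without any integrability of members of `W`. The
  -- dense sequence consists of minimizers of ∫ φ q, for q in a dense sequence.
  let φ : Euc d → (Ω → Euc d) → Ω → ℝ≥0∞ := fun q f ω => min (edist (f ω) q) 1
  have hφ : ∀ q, ∀ f ∈ W, Measurable (φ q f) := fun q f hf =>
    Measurable.min (((hmeas f hf).mono hm le_rfl).edist measurable_const) measurable_const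
  have hfin : ∀ q f, ∫⁻ ω, φ q f ω ∂P ≠ ∞ := fun q f =>
    ((lintegral_mono fun ω => min_le_right _ _).trans_lt
      (by simp [measure_lt_top])).ne
  have hinf : ∀ q (j : ℕ), ∃ f ∈ W, ∫⁻ ω, φ q f ω ∂P ≤
      (⨅ f ∈ W, ∫⁻ ω, φ q f ω ∂P) + ((j : ℝ≥0∞) + 1)⁻¹ := by
    intro q j
    obtain ⟨f₀, hf₀⟩ := hne
    have hlt : (⨅ f ∈ W, ∫⁻ ω, φ q f ω ∂P) <
        (⨅ f ∈ W, ∫⁻ ω, φ q f ω ∂P) + ((j : ℝ≥0∞) + 1)⁻¹ :=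
      ENNReal.lt_add_right (ne_top_of_le_ne_top (hfin q f₀) (iInf₂_le f₀ hf₀)) (by simp)
    obtain ⟨f, hf⟩ := iInf_lt_iff.1 hlt
    obtain ⟨hfW, hf⟩ := iInf_lt_iff.1 hf
    exact ⟨f, hfW, hf.le⟩
  choose F hFW hF using hinf
  -- Decomposability turns minimality of the integral into pointwise minimality: splicing `g` into
  -- `F q j` where `g` is nearer to q stays in `W`, so it can lower the integral by at most 1/(j+1).
  have hmin : ∀ q, ∀ g ∈ W, ∀ᵐ ω ∂P, ⨅ j, φ q (F q j) ω ≤ φ q g ω := by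
    intro q g hg
    have hI : Measurable fun ω => ⨅ j, φ q (F q j) ω := Measurable.iInf fun j => hφ q _ (hFW q j)
    have hz : ∫⁻ ω, ((⨅ j, φ q (F q j) ω) - φ q g ω) ∂P = 0 := by
      refine le_antisymm (ge_of_tendsto' (x := atTop)
        (f := fun j : ℕ => ((j : ℝ≥0∞) + 1)⁻¹) ?_ fun j => ?_) zero_le
      · have := ENNReal.tendsto_inv_nat_nhds_zero.comp (tendsto_add_atTop_nat 1)
        simpa [Function.comp_def] using this
      · let A : Set Ω := {ω | edist (g ω) q < edist (F q j ω) q}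
        have hA : MeasurableSet[m] A := 
          measurableSet_edist_lt_edist (hmeas g hg) (hmeas _ (hFW q j)) q
        have hh := hW g hg _ (hFW q j) A hA
        have hφh : φ q (A.indicator g + Aᶜ.indicator (F q j)) =
            fun ω => min (φ q g ω) (φ q (F q j) ω) := by
          funext ω
          simp only [φ, indicator_add_indicator_compl_apply]
          split_ifs with h
          · exact (min_eq_left (min_le_min_right _ (le_of_lt h))).symm
          · exact (min_eq_right (min_le_min_right _ (not_lt.1 h))).symm
        have h1 : (⨅ f ∈ W, ∫⁻ ω, φ q f ω ∂P) ≤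
            ∫⁻ ω, min (φ q g ω) (φ q (F q j) ω) ∂P := by
          rw [← hφh]
          exact iInf₂_le _ hh
        calc ∫⁻ ω, ((⨅ j, φ q (F q j) ω) - φ q g ω) ∂P
            ≤ ∫⁻ ω, (φ q (F q j) ω - min (φ q g ω) (φ q (F q j) ω)) ∂P := by
              refine lintegral_mono fun ω => ?_
              exact tsub_le_tsub (iInf_le _ j) (min_le_left _ _)
          _ = ∫⁻ ω, φ q (F q j) ω ∂P - ∫⁻ ω, min (φ q g ω) (φ q (F q j) ω) ∂P :=
              lintegral_sub ((hφ q g hg).min (hφ q _ (hFW q j)))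
                (ne_top_of_le_ne_top (hfin q g) (lintegral_mono fun ω => min_le_left _ _))
                (Eventually.of_forall fun ω => min_le_right _ _)
          _ ≤ ((j : ℝ≥0∞) + 1)⁻¹ := by
              refine tsub_le_iff_left.2 ((hF q j).trans ?_)
              gcongr
    filter_upwards [(lintegral_eq_zero_iff (hI.sub (hφ q g hg))).1 hz] with ω hω
    exact tsub_eq_zero_iff_le.1 hω
  let e := TopologicalSpace.denseSeq (Euc d)
  refine ⟨fun n => F (e n.unpair.1) n.unpair.2, fun n => hFW _ _, fun g hg => ?_⟩
  filter_upwards [ae_all_iff.2 fun i => hmin (e i) g hg] with ω hω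
  refine EMetric.mem_closure_iff.2 fun ε hε => ?_
  -- A radius at most 1 makes the truncation in φ inactive.
  have hε' : 0 < min (ε / 2) 1 := lt_min (ENNReal.half_pos hε.ne') one_pos
  obtain ⟨_, ⟨i, rfl⟩, hi⟩ := EMetric.mem_closure_iff.1
    (TopologicalSpace.denseRange_denseSeq (Euc d) (g ω)) _ hε'
  have h1 : ⨅ j, φ (e i) (F (e i) j) ω < min (ε / 2) 1 :=
    (hω i).trans_lt ((min_le_left _ _).trans_lt hi)
  obtain ⟨j, hj⟩ := iInf_lt_iff.1 h1
  have hj' : edist (F (e i) j ω) (e i) < min (ε / 2) 1 := by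
    rcases min_lt_iff.1 hj with h | h
    · exact h
    · exact absurd (h.trans_le (min_le_right _ _)) (lt_irrefl _)
  refine ⟨F (e i) j ω, ⟨Nat.pair i j, by simp⟩, ?_⟩
  calc edist (g ω) (F (e i) j ω) ≤ edist (g ω) (e i) + edist (F (e i) j ω) (e i) :=
        edist_triangle_right _ _ _
    _ < ε / 2 + ε / 2 :=
        ENNReal.add_lt_add (hi.trans_le (min_le_left _ _)) (hj'.trans_le (min_le_left _ _))
    _ = ε := ENNReal.add_halves ε

/-- A closed decomposable hull is the set of square integrable selectors of a measurable set-valued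
map (Hiai and Umegaki). -/
theorem exists_selectors_eq_closedDec [IsFiniteMeasure P] (hm : m ≤ mΩ) (hV : V ⊆ L2 P m)
    (hne : V.Nonempty) :
    ∃ I : Ω → Set (Euc d), SetMeasurable m I ∧ selectors P m I = closedDec P m V := by
  obtain ⟨f, hf, hdense⟩ := (decomposable_dec m V).exists_seq_dense (P := P) hm
    (hne.mono (subset_dec m V)) fun f hf => (dec_subset_L2 hm hV hf).1
  refine ⟨fun ω => closure (Set.range fun n => f n ω),
    setMeasurable_closure_range fun n => (dec_subset_L2 hm hV (hf n)).1,
    subset_antisymm (fun u hu => mem_closedDec_of_ae_mem_closure hm hV hf hu.1 hu.2)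
      fun u hu => ⟨hu.1, ?_⟩⟩
  exact ae_mem_of_mem_closedDec hm hV (Eventually.of_forall fun ω => isClosed_closure)
    (fun v hv => hdense v (subset_dec m V hv)) hu

/-- A Castaing sequence of square integrable selectors of either map consists of selectors of the
other. -/
theorem SetMeasurable.ae_eq_of_selectors_eq [IsFiniteMeasure P] (hm : m ≤ mΩ)
    {G H : Ω → Set (Euc d)} (hG : SetMeasurable m G) (hH : SetMeasurable m H)
    (hne : (selectors P m G).Nonempty) (h : selectors P m G = selectors P m H) : G =ᵐ[P] H := by
  obtain ⟨f, hf⟩ := hne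
  obtain ⟨u, hu, hGu⟩ := hG.exists_castaing_selectors hm hf
  obtain ⟨v, hv, hHv⟩ := hH.exists_castaing_selectors hm (h ▸ hf)
  filter_upwards [hGu, hHv, ae_all_iff.2 fun n => (h ▸ hu n : u n ∈ selectors P m H).2,
    ae_all_iff.2 fun n => (h.symm ▸ hv n : v n ∈ selectors P m G).2] with ω h1 h2 h3 h4
  refine subset_antisymm ?_ ?_
  · rw [h1]
    exact closure_minimal (by rintro _ ⟨n, rfl⟩; exact h3 n) (hH.isClosed ω)
  · rw [h2]
    exact closure_minimal (by rintro _ ⟨n, rfl⟩; exact h4 n) (hG.isClosed ω)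

theorem selectors_congr {G H : Ω → Set (Euc d)} (h : G =ᵐ[P] H) :
    selectors P m G = selectors P m H := by
  ext f
  refine and_congr_right fun _ => eventually_congr ?_
  filter_upwards [h] with ω hω
  rw [hω]

theorem SetMeasurable.congr_ae {G H : Ω → Set (Euc d)} (hG : SetMeasurable m G)
    (hnull : ∀ N : Set Ω, P N = 0 → MeasurableSet[m] N) (hne : ∀ ω, (H ω).Nonempty)
    (hcl : ∀ ω, IsClosed (H ω)) (h : G =ᵐ[P] H) : SetMeasurable m H := by
  refine ⟨hne, hcl, fun E hE => ?_⟩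
  have hN : P {ω | G ω ≠ H ω} = 0 := h
  have : {ω | (H ω ∩ E).Nonempty} = ({ω | (G ω ∩ E).Nonempty} \ {ω | G ω ≠ H ω}) ∪
      ({ω | (H ω ∩ E).Nonempty} ∩ {ω | G ω ≠ H ω}) := by
    ext ω
    by_cases hω : G ω = H ω <;> simp [hω]
  rw [this]
  exact ((hG.measurableSet_hit E hE).diff (hnull _ hN)).union
    (hnull _ (measure_mono_null Set.inter_subset_right hN))

end Decomposability

/-! ### Auxiliary facts on integrals and null sets -/

theorem sq_lintegral_le {S : Type*} [MeasurableSpace S] {ν : Measure S} {f : S → ℝ≥0∞}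
    (hf : AEMeasurable f ν) :
    (∫⁻ s, f s ∂ν) ^ 2 ≤ ν Set.univ * ∫⁻ s, f s ^ 2 ∂ν := by
  have h := ENNReal.lintegral_mul_le_Lp_mul_Lq ν (p := 2) (q := 2)
    Real.HolderConjugate.two_two hf (aemeasurable_const (b := (1 : ℝ≥0∞)))
  have h2 := pow_le_pow_left₀ zero_le h 2
  simp only [Pi.mul_apply, mul_one, mul_pow, ENNReal.one_rpow, lintegral_const, one_mul,
    ← ENNReal.rpow_natCast, ← ENNReal.rpow_mul] at h2
  norm_num at h2
  rwa [mul_comm] at h2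

theorem memLp_two_iff_lintegral_sq {α E : Type*} [NormedAddCommGroup E] {_ : MeasurableSpace α}
    {μ : Measure α} {f : α → E}
    (hf : AEStronglyMeasurable f μ) : MemLp f 2 μ ↔ ∫⁻ x, ‖f x‖ₑ ^ 2 ∂μ < ∞ := by
  rw [MemLp, eLpNorm_lt_top_iff_lintegral_rpow_enorm_lt_top (by norm_num) (by norm_num)]
  simp [hf]

theorem measurable_of_ae_eq {Ω β : Type*} {m mΩ : MeasurableSpace Ω} {P : Measure Ω}
    [MeasurableSpace β] {f g : Ω → β}
    (hnull : ∀ N : Set Ω, P N = 0 → MeasurableSet[m] N) (hg : Measurable[m] g) (h : f =ᵐ[P] g) :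
    Measurable[m] f := by
  intro s hs
  have hN : P {ω | f ω ≠ g ω} = 0 := h
  have : f ⁻¹' s = (g ⁻¹' s \ {ω | f ω ≠ g ω}) ∪ (f ⁻¹' s ∩ {ω | f ω ≠ g ω}) := by
    ext ω
    by_cases hω : f ω = g ω <;> simp [hω]
  rw [this]
  exact ((hg hs).diff (hnull _ hN)).union
    (hnull _ (measure_mono_null Set.inter_subset_right hN))

theorem measurable_toLp_of_forall {X : Type*} {_ : MeasurableSpace X} {d : ℕ}
    {f : X → Fin d → ℝ} (hf : ∀ i, Measurable fun x => f x i) :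
    Measurable fun x => (WithLp.toLp 2 (f x) : Euc d) :=
  (PiLp.continuous_toLp 2 _).measurable.comp (measurable_pi_lambda _ hf)

/-! ### Measurability of parametric integrals with respect to a sub-σ-algebra -/

section ParametricIntegral

variable {S Ω E : Type*} [MeasurableSpace S] {ν : Measure S} [IsFiniteMeasure ν]
  {m mΩ : MeasurableSpace Ω} {P : Measure Ω} [IsFiniteMeasure P]
  [NormedAddCommGroup E] [NormedSpace ℝ E]

theorem ae_ae_swap_of_ae_prod {p : S × Ω → Prop} (h : ∀ᵐ z ∂ν.prod P, p z) :
    ∀ᵐ ω ∂P, ∀ᵐ s ∂ν, p (s, ω) :=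
  Measure.ae_ae_of_ae_prod
    (p := fun z : Ω × S => p z.swap) (Measure.measurePreserving_swap.quasiMeasurePreserving.ae h)

theorem memLp_two_integral {f : S × Ω → E} (hf : StronglyMeasurable f)
    (hf2 : MemLp f 2 (ν.prod P)) : MemLp (fun ω => ∫ s, f (s, ω) ∂ν) 2 P := by
  rw [memLp_two_iff_lintegral_sq hf.integral_prod_left'.aestronglyMeasurable]
  rw [memLp_two_iff_lintegral_sq hf2.1, lintegral_prod_symm _ (hf.enorm.pow_const 2).aemeasurable]
    at hf2
  calc ∫⁻ ω, ‖∫ s, f (s, ω) ∂ν‖ₑ ^ 2 ∂P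
      ≤ ∫⁻ ω, ν Set.univ * ∫⁻ s, ‖f (s, ω)‖ₑ ^ 2 ∂ν ∂P := by
        refine lintegral_mono fun ω => le_trans ?_ (sq_lintegral_le
          (hf.enorm.comp measurable_prodMk_right).aemeasurable)
        exact pow_le_pow_left₀ zero_le (enorm_integral_le_lintegral_enorm _) 2
    _ = ν Set.univ * ∫⁻ ω, ∫⁻ s, ‖f (s, ω)‖ₑ ^ 2 ∂ν ∂P :=
        lintegral_const_mul' _ _ (measure_ne_top _ _)
    _ < ∞ := ENNReal.mul_lt_top (measure_lt_top _ _) hf2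

/-- Conditional expectation is the orthogonal projection in L². -/
theorem integral_sub_condExp_mul_eq_zero (hm : m ≤ mΩ) {U g : Ω → ℝ} (hU : MemLp U 2 P)
    (hg : StronglyMeasurable[m] g) (hg2 : MemLp g 2 P) : ∫ ω, (U - P[U|m]) ω * g ω ∂P = 0 := by
  have hV : MemLp (P[U|m]) 2 P := hU.condExp (by norm_num)
  have hUi : Integrable U P := hU.integrable (by norm_num)
  have hZi : Integrable (U - P[U|m]) P := hUi.sub integrable_condExp
  have hZ : P[U - P[U|m]|m] =ᵐ[P] 0 := by
    filter_upwards [condExp_sub hUi (integrable_condExp (f := U) (m := m)) m] with ω hω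
    rw [hω, condExp_of_stronglyMeasurable hm stronglyMeasurable_condExp integrable_condExp]
    simp
  have h1 := condExp_mul_of_stronglyMeasurable_right hg ((hU.sub hV).integrable_mul hg2) hZi
  calc ∫ ω, (U - P[U|m]) ω * g ω ∂P = ∫ ω, (P[(U - P[U|m]) * g|m]) ω ∂P :=
        (integral_condExp hm).symm
    _ = ∫ ω, (0 : ℝ) ∂P := by
        refine integral_congr_ae ?_
        filter_upwards [h1, hZ] with ω h2 h3
        rw [h2, Pi.mul_apply, h3]
        simp
    _ = 0 := by simp

/-- The integral of a jointly measurable family of `m`-measurable functions is `m`-measurable up to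
a null set. -/
theorem integral_ae_eq_condExp (hm : m ≤ mΩ) {f : S × Ω → ℝ} (hf : StronglyMeasurable f)
    (hf2 : MemLp f 2 (ν.prod P)) (hfm : ∀ᵐ s ∂ν, StronglyMeasurable[m] fun ω => f (s, ω)) :
    (fun ω => ∫ s, f (s, ω) ∂ν) =ᵐ[P] P[fun ω => ∫ s, f (s, ω) ∂ν|m] := by
  set U : Ω → ℝ := fun ω => ∫ s, f (s, ω) ∂ν with hUdef
  have hU : MemLp U 2 P := memLp_two_integral hf hf2
  have hV : MemLp (P[U|m]) 2 P := hU.condExp (by norm_num)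
  have hZ : MemLp (U - P[U|m]) 2 P := hU.sub hV
  -- By Fubini, the residual Z = U - P[U|m] is orthogonal to `U`, being orthogonal to almost every
  -- section of `f`. It is also orthogonal to P[U|m], so E[Z²] = 0.
  have hZU : ∫ ω, (U - P[U|m]) ω * U ω ∂P = 0 := by
    have hint : Integrable (fun z : S × Ω => (U - P[U|m]) z.2 * f z) (ν.prod P) :=
      (hZ.comp_snd ν).integrable_mul hf2
    have hsec : ∀ᵐ s ∂ν, Integrable (fun ω => ‖f (s, ω)‖ ^ 2) P :=
      ((memLp_two_iff_integrable_sq_norm hf2.1).1 hf2).prod_right_ae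
    calc ∫ ω, (U - P[U|m]) ω * U ω ∂P = ∫ ω, ∫ s, (U - P[U|m]) ω * f (s, ω) ∂ν ∂P := by
          simp_rw [integral_const_mul, hUdef]
      _ = ∫ s, ∫ ω, (U - P[U|m]) ω * f (s, ω) ∂P ∂ν :=
          (integral_integral_swap (f := fun s ω => (U - P[U|m]) ω * f (s, ω)) hint).symm
      _ = ∫ s, (0 : ℝ) ∂ν := by
          refine integral_congr_ae ?_
          filter_upwards [hfm, hsec] with s h1 h2
          exact integral_sub_condExp_mul_eq_zero hm hU h1
            ((memLp_two_iff_integrable_sq_norm (h1.mono hm).aestronglyMeasurable).2 h2)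
      _ = 0 := by simp
  have hZV := integral_sub_condExp_mul_eq_zero hm hU stronglyMeasurable_condExp hV
  have hZZ : ∫ ω, ((U - P[U|m]) ω) ^ 2 ∂P = 0 := by
    have : ∀ ω, ((U - P[U|m]) ω) ^ 2 = (U - P[U|m]) ω * U ω - (U - P[U|m]) ω * (P[U|m]) ω := by
      intro ω
      simp only [Pi.sub_apply]
      ring
    simp_rw [this]
    refine (integral_sub (hZ.integrable_mul hU) (hZ.integrable_mul hV)).trans ?_
    exact (congrArg₂ _ hZU hZV).trans (sub_zero 0)
  have := (integral_eq_zero_iff_of_nonneg (fun ω => sq_nonneg _) hZ.integrable_sq).1 hZZ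
  filter_upwards [this] with ω hω
  have h0 : (U - P[U|m]) ω = 0 := by simpa using hω
  exact sub_eq_zero.1 h0

/-- Joint measurability refers to `mΩ`, so Fubini alone does not give `m`-measurability. Each
coordinate is a.s. equal to a conditional expectation, and `m` contains the null sets. -/
theorem measurable_integral_of_ae_measurable {d : ℕ} (hm : m ≤ mΩ)
    (hnull : ∀ N : Set Ω, P N = 0 → MeasurableSet[m] N) {f : S × Ω → Euc d} (hf : Measurable f)
    (hf2 : MemLp f 2 (ν.prod P)) (hfm : ∀ᵐ s ∂ν, Measurable[m] fun ω => f (s, ω)) :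
    Measurable[m] fun ω => ∫ s, f (s, ω) ∂ν := by
  have hcoord : ∀ i, Measurable[m] fun ω => ∫ s, f (s, ω) i ∂ν := by
    intro i
    have hci : Continuous fun x : Euc d => x i := by fun_prop
    refine measurable_of_ae_eq (P := P) hnull ?_ (integral_ae_eq_condExp (m := m) hm
      (f := fun z => f z i) (hci.measurable.comp hf).stronglyMeasurable ?_ ?_)
    · exact stronglyMeasurable_condExp.measurable
    · refine hf2.mono (hci.measurable.comp hf).aestronglyMeasurable
        (Eventually.of_forall fun z => ?_)
      exact PiLp.norm_apply_le (f z) i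
    · filter_upwards [hfm] with s hs
      exact (hci.measurable.comp hs).stronglyMeasurable
  have hint : ∀ᵐ ω ∂P, Integrable (fun s => f (s, ω)) ν :=
    (hf2.integrable (by norm_num)).prod_left_ae
  refine measurable_of_ae_eq (P := P) hnull
    (g := fun ω => WithLp.toLp 2 fun i => ∫ s, f (s, ω) i ∂ν) ?_ ?_
  · exact measurable_toLp_of_forall hcoord
  · filter_upwards [hint] with ω hω
    ext i
    exact ((EuclideanSpace.proj (𝕜 := ℝ) i).integral_comp_comm hω).symm

end ParametricIntegral

/-! ### Closed convex cones and Jensen's inequality -/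

section Cone

variable {d : ℕ} {C : Set (Euc d)}

theorem IsGeneratingCone.zero_mem (hC : IsGeneratingCone C) : (0 : Euc d) ∈ C := by
  obtain ⟨c, hc⟩ := hC.nonempty
  have h : Tendsto (fun n : ℕ => (1 / ((n : ℝ) + 1)) • c) atTop (𝓝 ((0 : ℝ) • c)) :=
    tendsto_one_div_add_atTop_nhds_zero_nat.smul_const c
  rw [zero_smul] at h
  exact hC.isClosed.mem_of_tendsto h
    (Eventually.of_forall fun n => hC.smul_mem _ (by positivity) c hc)

theorem IsGeneratingCone.add_mem (hC : IsGeneratingCone C) {x y : Euc d} (hx : x ∈ C)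
    (hy : y ∈ C) : x + y ∈ C := by
  have h := hC.smul_mem 2 two_pos _
    (hC.convex hx hy (a := 1 / 2) (b := 1 / 2) (by norm_num) (by norm_num) (by norm_num))
  simpa [smul_smul] using h

theorem IsGeneratingCone.smul_mem_of_nonneg (hC : IsGeneratingCone C) {a : ℝ} (ha : 0 ≤ a)
    {x : Euc d} (hx : x ∈ C) : a • x ∈ C := by
  rcases ha.eq_or_lt with rfl | ha
  · simpa using hC.zero_mem
  · exact hC.smul_mem a ha x hx

theorem IsGeneratingCone.integral_mem {S : Type*} [MeasurableSpace S] {ν : Measure S}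
    [IsFiniteMeasure ν] (hC : IsGeneratingCone C) {f : S → Euc d} (hf : Integrable f ν)
    (hfC : ∀ s, f s ∈ C) : ∫ s, f s ∂ν ∈ C := by
  rcases eq_or_ne ν 0 with rfl | hν
  · simpa using hC.zero_mem
  · have : NeZero ν := ⟨hν⟩
    rw [← measure_smul_average]
    exact hC.smul_mem_of_nonneg ENNReal.toReal_nonneg
      (hC.convex.average_mem hC.isClosed (Eventually.of_forall hfC) hf)

theorem SetMeasurable.exists_measurable_selection_edist {X : Type*} {m : MeasurableSpace X}
    {G : X → Set (Euc d)} (hG : SetMeasurable m G) {f : X → Euc d} (hf : Measurable f) {ε : ℝ}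
    (hε : 0 < ε) :
    ∃ u : X → Euc d, Measurable u ∧ (∀ x, u x ∈ G x) ∧
      ∀ x, edist (f x) (u x) ≤ Metric.infEDist (f x) (G x) + ENNReal.ofReal ε := by
  obtain ⟨u, hu, huG, hfu⟩ := hG.exists_measurable_selection hf hε
  refine ⟨u, hu, huG, fun x => ?_⟩
  rw [edist_dist, ← ENNReal.ofReal_toReal (Metric.infEDist_ne_top (hG.nonempty x)),
    ← ENNReal.ofReal_add ENNReal.toReal_nonneg hε.le]
  exact ENNReal.ofReal_le_ofReal (hfu x)

theorem le_of_forall_le_add_ofReal {a b c : ℝ≥0∞} (hc : c ≠ ∞)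
    (h : ∀ n : ℕ, a ≤ b + ENNReal.ofReal (1 / ((n : ℝ) + 1)) * c) : a ≤ b := by
  have h1 : Tendsto (fun n : ℕ => ENNReal.ofReal (1 / ((n : ℝ) + 1))) atTop (𝓝 0) := by
    simpa using ENNReal.tendsto_ofReal tendsto_one_div_add_atTop_nhds_zero_nat
  have h2 := (ENNReal.Tendsto.mul_const (b := c) h1 (Or.inr hc)).const_add b
  rw [zero_mul, add_zero] at h2
  exact ge_of_tendsto' h2 h

/-- Jensen's inequality for the distance to a closed convex cone. -/
theorem IsGeneratingCone.infEDist_integral_le {S : Type*} [MeasurableSpace S] {ν : Measure S}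
    [IsFiniteMeasure ν] (hC : IsGeneratingCone C) {f : S → Euc d} (hf : Integrable f ν) :
    Metric.infEDist (∫ s, f s ∂ν) C ≤ ∫⁻ s, Metric.infEDist (f s) C ∂ν := by
  have hCm : SetMeasurable (borel (Euc d)) fun _ : Euc d => C :=
    ⟨fun _ => hC.nonempty, fun _ => hC.isClosed, fun E _ => MeasurableSet.const _⟩
  rw [← BorelSpace.measurable_eq] at hCm
  refine le_of_forall_le_add_ofReal (measure_ne_top ν Set.univ) fun n => ?_
  -- An almost nearest-point map onto `C`; the integral of `p ∘ f` lies in `C` and competes for the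
  -- distance.
  obtain ⟨p, hp, hpC, hpd⟩ := hCm.exists_measurable_selection_edist measurable_id
    (show (0 : ℝ) < 1 / ((n : ℝ) + 1) by positivity)
  set ε : ℝ≥0∞ := ENNReal.ofReal (1 / ((n : ℝ) + 1))
  have hsub : Integrable (fun s => f s - p (f s)) ν := by
    refine ⟨hf.1.sub (hp.comp_aemeasurable hf.1.aemeasurable).aestronglyMeasurable, ?_⟩
    calc ∫⁻ s, ‖f s - p (f s)‖ₑ ∂ν ≤ ∫⁻ s, (‖f s‖ₑ + ε) ∂ν := by
          refine lintegral_mono fun s => ?_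
          rw [← edist_eq_enorm_sub]
          refine (hpd (f s)).trans ?_
          gcongr
          simpa using Metric.infEDist_le_edist_of_mem (x := f s) hC.zero_mem
      _ < ∞ := by
          rw [lintegral_add_right _ measurable_const, lintegral_const]
          exact ENNReal.add_lt_top.2
            ⟨hf.2, ENNReal.mul_lt_top ENNReal.ofReal_lt_top (measure_lt_top _ _)⟩
  have hpf : Integrable (fun s => p (f s)) ν := by
    refine (hf.sub hsub).congr (Eventually.of_forall fun s => ?_)
    simp
  calc Metric.infEDist (∫ s, f s ∂ν) C ≤ edist (∫ s, f s ∂ν) (∫ s, p (f s) ∂ν) :=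
        Metric.infEDist_le_edist_of_mem (hC.integral_mem hpf fun s => hpC _)
    _ = ‖∫ s, (f s - p (f s)) ∂ν‖ₑ := by rw [edist_eq_enorm_sub, integral_sub hf hpf]
    _ ≤ ∫⁻ s, ‖f s - p (f s)‖ₑ ∂ν := enorm_integral_le_lintegral_enorm _
    _ ≤ ∫⁻ s, (Metric.infEDist (f s) C + ε) ∂ν := by
        refine lintegral_mono fun s => ?_
        rw [← edist_eq_enorm_sub]
        exact hpd (f s)
    _ = ∫⁻ s, Metric.infEDist (f s) C ∂ν + ε * ν Set.univ := by
        rw [lintegral_add_right _ measurable_const, lintegral_const]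

end Cone

/-! ### Lebesgue measure on the time interval -/

section Time

variable {T : ℝ}

theorem timeMeasure_apply (s : Set (Set.Icc (0 : ℝ) T)) :
    timeMeasure T s = volume (Subtype.val '' s) :=
  comap_subtype_coe_apply measurableSet_Icc volume s

instance : IsFiniteMeasure (timeMeasure T) :=
  ⟨by rw [timeMeasure_apply]
      exact (measure_mono (Subtype.coe_image_subset _ _)).trans_lt measure_Icc_lt_top⟩

instance : NullSingletonClass (timeMeasure T) :=
  ⟨fun x => by rw [timeMeasure_apply, Set.image_singleton]; exact measure_singleton _⟩

theorem timeMeasure_real_Ioc {s t : Set.Icc (0 : ℝ) T} (hst : s ≤ t) :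
    (timeMeasure T).real (Set.Ioc s t) = (t : ℝ) - s := by
  have : Subtype.val '' Set.Ioc s t = Set.Ioc (s : ℝ) t := by
    ext x
    constructor
    · rintro ⟨y, hy, rfl⟩
      exact hy
    · rintro ⟨h1, h2⟩
      exact ⟨⟨x, s.2.1.trans h1.le, h2.trans t.2.2⟩, ⟨h1, h2⟩, rfl⟩
  rw [measureReal_def, timeMeasure_apply, this, Real.volume_Ioc,
    ENNReal.toReal_ofReal (sub_nonneg.2 hst)]

theorem timeMeasure_real_Iic (t : Set.Icc (0 : ℝ) T) :
    (timeMeasure T).real (Set.Iic t) = t := by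
  have : Subtype.val '' Set.Iic t = Set.Icc (0 : ℝ) t := by
    ext x
    constructor
    · rintro ⟨y, hy, rfl⟩
      exact ⟨y.2.1, hy⟩
    · rintro ⟨h1, h2⟩
      exact ⟨⟨x, h1, h2.trans t.2.2⟩, h2, rfl⟩
  rw [measureReal_def, timeMeasure_apply, this, Real.volume_Icc, sub_zero,
    ENNReal.toReal_ofReal t.2.1]

end Time

/-! ### Nonanticipative selectors and the integral -/

section Processes

variable {Ω : Type*} {mΩ : MeasurableSpace Ω} {d : ℕ} {T : ℝ}

/-- The σ-algebra of non-anticipative subsets of `[0, T] × Ω`. -/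
abbrev nonAnticipativeSpace (ℱ : Filtration (Set.Icc (0 : ℝ) T) mΩ) :
    MeasurableSpace (Set.Icc (0 : ℝ) T × Ω) where
  MeasurableSet' A := MeasurableSet A ∧ ∀ t, MeasurableSet[ℱ t] (Prod.mk t ⁻¹' A)
  measurableSet_empty := by simp
  measurableSet_compl A hA := ⟨hA.1.compl, fun t => (hA.2 t).compl⟩
  measurableSet_iUnion f hf := ⟨MeasurableSet.iUnion fun i => (hf i).1, fun t => by
    rw [Set.preimage_iUnion]
    exact MeasurableSet.iUnion fun i => (hf i).2 t⟩

/-- The pathwise integral `∫ₛᵗ h(F_r, C) dr`. -/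
noncomputable def hausdorffIntegral (F : Set.Icc (0 : ℝ) T → Ω → Set (Euc d)) (C : Set (Euc d))
    (s t : Set.Icc (0 : ℝ) T) (ω : Ω) : ℝ≥0∞ :=
  ∫⁻ r in Set.Ioc s t, Metric.hausdorffEDist (F r ω) C ∂(timeMeasure T)

variable {P : Measure Ω} {ℱ : Filtration (Set.Icc (0 : ℝ) T) mΩ}
  {C : Set (Euc d)} {F : Set.Icc (0 : ℝ) T → Ω → Set (Euc d)}
  {φ : Set.Icc (0 : ℝ) T → Ω → Euc d}

/-- With a single σ-algebra encoding both requirements, the selection theorems directly produce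
nonanticipative selectors. -/
theorem nonAnticipative_iff_measurable :
    NonAnticipative ℱ φ ↔ Measurable[nonAnticipativeSpace ℱ] fun p => φ p.1 p.2 :=
  ⟨fun h _ hA => ⟨h.1 hA, fun t => h.2 t hA⟩,
    fun h => ⟨fun _ hA => (h hA).1, fun t _ hA => (h hA).2 t⟩⟩

theorem SetNonAnticipative.setMeasurable (hF : SetNonAnticipative ℱ F) :
    SetMeasurable (nonAnticipativeSpace ℱ) fun p => F p.1 p.2 :=
  ⟨hF.1.nonempty, hF.1.isClosed, fun E hE =>
    ⟨hF.1.measurableSet_hit E hE, fun t => (hF.2 t).measurableSet_hit E hE⟩⟩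

theorem measurableSet_nonAnticipative_le (s : Set.Icc (0 : ℝ) T) :
    MeasurableSet[nonAnticipativeSpace ℱ] {p | p.1 ≤ s} :=
  ⟨measurableSet_le measurable_fst measurable_const, fun t => MeasurableSet.const (t ≤ s)⟩

theorem integralsOfSelectors_nonempty (hF : MemL2CF P ℱ C F) (t : Set.Icc (0 : ℝ) T) :
    (integralsOfSelectors P ℱ F t).Nonempty := by
  obtain ⟨φ, hφ⟩ := hF.selectors_nonempty
  exact ⟨_, φ, hφ, rfl⟩

variable [IsProbabilityMeasure P]

theorem ae_integrable_of_mem_processSelectors (hφ : φ ∈ processSelectors P ℱ F) :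
    ∀ᵐ ω ∂P, Integrable (fun r => φ r ω) (timeMeasure T) :=
  (hφ.2.1.integrable (by norm_num)).prod_left_ae

theorem ae_ae_mem_of_mem_processSelectors (hφ : φ ∈ processSelectors P ℱ F) :
    ∀ᵐ ω ∂P, ∀ᵐ r ∂(timeMeasure T), φ r ω ∈ F r ω :=
  ae_ae_swap_of_ae_prod hφ.2.2

theorem integralsOfSelectors_subset_L2 (hℱ : CompleteFiltration P ℱ) (t : Set.Icc (0 : ℝ) T) :
    integralsOfSelectors P ℱ F t ⊆ L2 P (ℱ t) := by
  rintro _ ⟨φ, hφ, rfl⟩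
  have h2 : MemLp (fun p : Set.Icc (0 : ℝ) T × Ω => φ p.1 p.2) 2
      (((timeMeasure T).restrict (Set.Iic t)).prod P) := by
    rw [Measure.restrict_prod_eq_prod_univ]
    exact hφ.2.1.mono_measure Measure.restrict_le_self
  refine ⟨measurable_integral_of_ae_measurable (ℱ.le t) (hℱ t) hφ.1.1 h2 ?_,
    memLp_two_integral hφ.1.1.stronglyMeasurable h2⟩
  filter_upwards [ae_restrict_mem measurableSet_Iic] with r hr
  exact (hφ.1.2 r).mono (ℱ.mono hr) le_rfl

theorem MemLC.add_mem {A : Set (Euc d)} (hA : MemLC C A) {x c : Euc d} (hx : x ∈ A) (hc : c ∈ C) :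
    x + c ∈ A := by
  rw [hA.add_cone]
  exact subset_closure (Set.add_mem_add hx hc)

/-- `F t ∈ L_C` holds a.s. for each t. Passing to the product measure needs a measurable event, so
the inclusion is tested on a dense sequence of `C` and a Castaing sequence of `F`, then closed up.
-/
theorem MemL2CF.ae_add_mem (hF : MemL2CF P ℱ C F) :
    ∀ᵐ p ∂((timeMeasure T).prod P), ∀ c ∈ C, ∀ x ∈ F p.1 p.2, x + c ∈ F p.1 p.2 := by
  obtain ⟨D, hDC, hD, hCD⟩ := (TopologicalSpace.IsSeparable.of_separableSpace
    C).exists_countable_dense_subset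
  have hFm := hF.nonAnticipative.1
  obtain ⟨u, hu, hFu⟩ := hFm.exists_castaing
  have hmeas : MeasurableSet {p : Set.Icc (0 : ℝ) T × Ω |
      ∀ c ∈ D, ∀ n, Metric.infEDist (u n p + c) (F p.1 p.2) = 0} := by
    have : {p : Set.Icc (0 : ℝ) T × Ω | ∀ c ∈ D, ∀ n,
        Metric.infEDist (u n p + c) (F p.1 p.2) = 0} = ⋂ c ∈ D, ⋂ n,
        {p | Metric.infEDist (u n p + c) (F p.1 p.2) = 0} := by
      ext p
      simp
    rw [this]
    exact MeasurableSet.biInter hD fun c _ => MeasurableSet.iInter fun n =>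
      hFm.measurable_infEDist ((hu n).add_const c) (measurableSet_singleton 0)
  have hae : ∀ᵐ p ∂((timeMeasure T).prod P), ∀ c ∈ D, ∀ n,
      Metric.infEDist (u n p + c) (F p.1 p.2) = 0 := by
    rw [Measure.ae_prod_iff_ae_ae hmeas]
    refine Eventually.of_forall fun t => ?_
    filter_upwards [hF.memLC t] with ω hω c hc n
    refine Metric.infEDist_zero_of_mem (hω.add_mem ?_ (hDC hc))
    have := hFu (t, ω)
    simp only at this
    rw [this]
    exact subset_closure ⟨n, rfl⟩
  filter_upwards [hae] with p hp c hc x hx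
  have hcl := hFm.isClosed p
  have hD' : ∀ c ∈ D, F p.1 p.2 ⊆ {x | x + c ∈ F p.1 p.2} := by
    intro c hc
    have hcl' : IsClosed {x | x + c ∈ F p.1 p.2} := hcl.preimage (continuous_add_const c)
    conv_lhs => rw [hFu p]
    refine closure_minimal ?_ hcl'
    rintro _ ⟨n, rfl⟩
    exact (Metric.mem_iff_infEDist_zero_of_closed hcl).2 (hp c hc n)
  have hcl' : IsClosed {c | x + c ∈ F p.1 p.2} := hcl.preimage (continuous_const_add x)
  exact closure_minimal (fun c hc => hD' c hc hx) hcl' (hCD hc)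

theorem add_const_mem_processSelectors (hF : MemL2CF P ℱ C F) (hφ : φ ∈ processSelectors P ℱ F)
    {c : Euc d} (hc : c ∈ C) : (fun r ω => φ r ω + c) ∈ processSelectors P ℱ F := by
  refine ⟨nonAnticipative_iff_measurable.2
    ((nonAnticipative_iff_measurable.1 hφ.1).add_const c), hφ.2.1.add (memLp_const c), ?_⟩
  filter_upwards [hφ.2.2, hF.ae_add_mem] with p h1 h2
  exact h2 c hc _ h1

theorem setIntegral_Iic_eq_add {f : Set.Icc (0 : ℝ) T → Euc d} (hf : Integrable f (timeMeasure T))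
    {s t : Set.Icc (0 : ℝ) T} (hst : s ≤ t) :
    ∫ r in Set.Iic t, f r ∂(timeMeasure T) =
      ∫ r in Set.Iic s, f r ∂(timeMeasure T) + ∫ r in Set.Ioc s t, f r ∂(timeMeasure T) := by
  rw [← Set.Iic_union_Ioc_eq_Iic hst, setIntegral_union (Set.Iic_disjoint_Ioc le_rfl)
    measurableSet_Ioc hf.integrableOn hf.integrableOn]

/-- Follow `φ` up to time s, then a selection of `F` almost nearest to c, whose distance from c is
at most h(F_r, C) + ε. -/
theorem exists_processSelectors_near (hF : MemL2CF P ℱ C F) (hφ : φ ∈ processSelectors P ℱ F)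
    {s t : Set.Icc (0 : ℝ) T} (hst : s ≤ t) {c : Euc d} (hc : c ∈ C) {ε : ℝ} (hε : 0 < ε) :
    ∃ ψ ∈ processSelectors P ℱ F, ∀ᵐ ω ∂P,
      edist (∫ r in Set.Iic s, φ r ω ∂(timeMeasure T) + ((t : ℝ) - s) • c)
        (∫ r in Set.Iic t, ψ r ω ∂(timeMeasure T)) ≤
      hausdorffIntegral F C s t ω + ENNReal.ofReal ε * timeMeasure T Set.univ := by
  classical
  obtain ⟨v, hv, hvF, hvd⟩ := hF.nonAnticipative.setMeasurable.exists_measurable_selection_edist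
    (f := fun _ => c) measurable_const hε
  let ψ : Set.Icc (0 : ℝ) T → Ω → Euc d := fun r ω => if r ≤ s then φ r ω else v (r, ω)
  have hψm : Measurable[nonAnticipativeSpace ℱ] fun p : Set.Icc (0 : ℝ) T × Ω => ψ p.1 p.2 :=
    Measurable.ite (measurableSet_nonAnticipative_le s) (nonAnticipative_iff_measurable.1 hφ.1) hv
  have hψN : NonAnticipative ℱ ψ := nonAnticipative_iff_measurable.2 hψm
  have hψ : ψ ∈ processSelectors P ℱ F := by
    refine ⟨hψN, ?_, ?_⟩
    · have hb : MemLp (fun p : Set.Icc (0 : ℝ) T × Ω => ‖φ p.1 p.2‖ + (‖c‖ + ‖c - φ p.1 p.2‖ + ε)) 2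
          ((timeMeasure T).prod P) :=
        hφ.2.1.norm.add ((((memLp_const c).norm).add ((memLp_const c).sub hφ.2.1).norm).add
          (memLp_const ε))
      refine hb.mono hψN.1.aestronglyMeasurable ?_
      filter_upwards [hφ.2.2] with p hp
      rw [Real.norm_of_nonneg (by positivity)]
      simp only [ψ]
      split_ifs
      · have := norm_nonneg c
        have := norm_nonneg (c - φ p.1 p.2)
        linarith
      · have h1 := (hvd p).trans (add_le_add_left (Metric.infEDist_le_edist_of_mem hp) _)
        rw [edist_dist, edist_dist, ← ENNReal.ofReal_add dist_nonneg hε.le,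
          ENNReal.ofReal_le_ofReal_iff (by positivity), dist_eq_norm, dist_eq_norm] at h1
        have h2 := norm_sub_norm_le (v p) c
        rw [norm_sub_rev] at h2
        have := norm_nonneg (φ p.1 p.2)
        simp only [Prod.mk.eta]
        linarith
    · filter_upwards [hφ.2.2] with p hp
      simp only [ψ]
      split_ifs
      · exact hp
      · exact hvF p
  refine ⟨ψ, hψ, ?_⟩
  filter_upwards [ae_integrable_of_mem_processSelectors hψ] with ω hω
  have h1 : ∫ r in Set.Iic s, ψ r ω ∂(timeMeasure T) = ∫ r in Set.Iic s, φ r ω ∂(timeMeasure T) :=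
    setIntegral_congr_fun measurableSet_Iic fun r hr => if_pos hr
  have h2 : ((t : ℝ) - s) • c = ∫ _ in Set.Ioc s t, c ∂(timeMeasure T) := by
    rw [setIntegral_const, timeMeasure_real_Ioc hst]
  rw [setIntegral_Iic_eq_add hω hst, h1, edist_add_left, h2, edist_eq_enorm_sub,
    ← integral_sub (integrable_const c) hω.integrableOn]
  calc ‖∫ r in Set.Ioc s t, (c - ψ r ω) ∂(timeMeasure T)‖ₑ
      ≤ ∫⁻ r in Set.Ioc s t, ‖c - ψ r ω‖ₑ ∂(timeMeasure T) := enorm_integral_le_lintegral_enorm _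
    _ ≤ ∫⁻ r in Set.Ioc s t, (Metric.hausdorffEDist (F r ω) C + ENNReal.ofReal ε)
          ∂(timeMeasure T) := by
        refine setLIntegral_mono' measurableSet_Ioc fun r hr => ?_
        have : ψ r ω = v (r, ω) := if_neg (not_le.2 hr.1)
        rw [this, ← edist_eq_enorm_sub, Metric.hausdorffEDist_comm]
        exact (hvd (r, ω)).trans
          (add_le_add_left (Metric.infEDist_le_hausdorffEDist_of_mem hc) _)
    _ ≤ _ := by
        rw [lintegral_add_right _ measurable_const, lintegral_const, hausdorffIntegral]
        gcongr
        exact Measure.restrict_le_self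

theorem integralsOfSelectors_subset_selectors (hℱ : CompleteFiltration P ℱ)
    {t : Set.Icc (0 : ℝ) T} {I : Ω → Set (Euc d)} (hI : IsSetIntegral P ℱ F t I) :
    integralsOfSelectors P ℱ F t ⊆ selectors P (ℱ t) I := by
  rw [hI.2]
  exact (subset_dec _ _).trans
    (dec_subset_closedDec (ℱ.le t) (integralsOfSelectors_subset_L2 hℱ t))

/-- A pointwise closed constraint that holds for the integrals of selectors holds for all points of
the set-valued integral. -/
theorem IsSetIntegral.ae_subset (hℱ : CompleteFiltration P ℱ) (hF : MemL2CF P ℱ C F)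
    {t : Set.Icc (0 : ℝ) T} {I : Ω → Set (Euc d)} (hI : IsSetIntegral P ℱ F t I)
    {Z : Ω → Set (Euc d)} (hZ : ∀ ω, IsClosed (Z ω))
    (h : ∀ v ∈ integralsOfSelectors P ℱ F t, ∀ᵐ ω ∂P, v ω ∈ Z ω) : ∀ᵐ ω ∂P, I ω ⊆ Z ω := by
  obtain ⟨f, hf⟩ := integralsOfSelectors_nonempty hF t
  obtain ⟨u, hu, hIu⟩ := hI.1.exists_castaing_selectors (ℱ.le t)
    (integralsOfSelectors_subset_selectors hℱ hI hf)
  have huZ : ∀ n, ∀ᵐ ω ∂P, u n ω ∈ Z ω := fun n =>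
    ae_mem_of_mem_closedDec (ℱ.le t) (integralsOfSelectors_subset_L2 hℱ t)
      (Eventually.of_forall hZ) h (hI.2 ▸ hu n)
  filter_upwards [hIu, ae_all_iff.2 huZ] with ω h1 h2
  rw [h1]
  exact closure_minimal (by rintro _ ⟨n, rfl⟩; exact h2 n) (hZ ω)

/-- Shifting a selector of `F` by the constant c/t shifts its integral over [0, t] by c; this is
where t > 0 matters. -/
theorem IsSetIntegral.ae_add_mem (hℱ : CompleteFiltration P ℱ)
    (hF : MemL2CF P ℱ C F) {t : Set.Icc (0 : ℝ) T} (ht : 0 < (t : ℝ)) {I : Ω → Set (Euc d)}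
    (hC : IsGeneratingCone C) (hI : IsSetIntegral P ℱ F t I) :
    ∀ᵐ ω ∂P, ∀ c ∈ C, ∀ x ∈ I ω, x + c ∈ I ω := by
  obtain ⟨D, hDC, hD, hCD⟩ := (TopologicalSpace.IsSeparable.of_separableSpace
    C).exists_countable_dense_subset
  have hconst : ∀ c ∈ D, ∀ᵐ ω ∂P, I ω ⊆ {x | x + c ∈ I ω} := by
    intro c hc
    refine hI.ae_subset hℱ hF (fun ω => (hI.1.isClosed ω).preimage (continuous_add_const c)) ?_
    rintro _ ⟨φ, hφ, rfl⟩
    have hc' : (t : ℝ)⁻¹ • c ∈ C := hC.smul_mem _ (inv_pos.2 ht) c (hDC hc)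
    have hmem := (integralsOfSelectors_subset_selectors hℱ hI
      ⟨_, add_const_mem_processSelectors hF hφ hc', rfl⟩).2
    filter_upwards [hmem, ae_integrable_of_mem_processSelectors hφ] with ω h1 h2
    rw [integral_add h2.integrableOn (integrable_const _), setIntegral_const, timeMeasure_real_Iic,
      smul_inv_smul₀ ht.ne'] at h1
    exact h1
  filter_upwards [(ae_ball_iff hD).2 hconst] with ω hω c hc x hx
  have hcl : IsClosed {c | x + c ∈ I ω} := (hI.1.isClosed ω).preimage (continuous_const_add x)
  exact closure_minimal (fun c hc => hω c hc hx) hcl (hCD hc)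

/-- `X` is a version at time `t` of the integral process: `C` at time zero and a set-valued integral
at positive times. -/
structure IsIntegralVersion (P : Measure Ω) (ℱ : Filtration (Set.Icc (0 : ℝ) T) mΩ)
    (C : Set (Euc d)) (F : Set.Icc (0 : ℝ) T → Ω → Set (Euc d)) (t : Set.Icc (0 : ℝ) T)
    (X : Ω → Set (Euc d)) : Prop where
  isSetIntegral : 0 < (t : ℝ) → IsSetIntegral P ℱ F t X
  eq_cone : (t : ℝ) = 0 → ∀ ω, X ω = C

theorem setIntegral_Iic_of_eq_zero {s : Set.Icc (0 : ℝ) T} (hs : (s : ℝ) = 0)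
    (f : Set.Icc (0 : ℝ) T → Euc d) : ∫ r in Set.Iic s, f r ∂(timeMeasure T) = 0 := by
  have : Set.Iic s = {s} := by
    ext r
    simp only [Set.mem_Iic, Set.mem_singleton_iff]
    refine ⟨fun h => le_antisymm h ?_, fun h => h.le⟩
    change (s : ℝ) ≤ r
    rw [hs]
    exact r.2.1
  rw [this]
  exact setIntegral_measure_zero _ (measure_singleton s)

/-! ### The Hausdorff estimate for increments -/

variable {s t : Set.Icc (0 : ℝ) T} {X Y : Ω → Set (Euc d)}

theorem IsIntegralVersion.ae_setIntegral_add_mem (hℱ : CompleteFiltration P ℱ)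
    (hC : IsGeneratingCone C) (hF : MemL2CF P ℱ C F) (hX : IsIntegralVersion P ℱ C F s X)
    (hφ : φ ∈ processSelectors P ℱ F) :
    ∀ᵐ ω ∂P, ∀ c ∈ C, ∫ r in Set.Iic s, φ r ω ∂(timeMeasure T) + c ∈ X ω := by
  rcases s.2.1.eq_or_lt with hs | hs
  · refine Eventually.of_forall fun ω c hc => ?_
    rwa [setIntegral_Iic_of_eq_zero hs.symm, zero_add, hX.eq_cone hs.symm]
  · have hI := hX.isSetIntegral hs
    filter_upwards [hI.ae_add_mem hℱ hF hs hC,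
      (integralsOfSelectors_subset_selectors hℱ hI ⟨φ, hφ, rfl⟩).2] with ω h1 h2 c hc
    exact h1 c hc _ h2

/-- Write ∫₀ᵗ φ = a + b, split at s. As a + C ⊆ X, the distance of a + b to X is at most that of b
to C, and Jensen's inequality applies. -/
theorem IsIntegralVersion.ae_infEDist_le_of_mem_right (hℱ : CompleteFiltration P ℱ)
    (hC : IsGeneratingCone C)
    (hF : MemL2CF P ℱ C F) (hst : s ≤ t) (hX : IsIntegralVersion P ℱ C F s X)
    (hY : IsIntegralVersion P ℱ C F t Y) :
    ∀ᵐ ω ∂P, ∀ y ∈ Y ω, Metric.infEDist y (X ω) ≤ hausdorffIntegral F C s t ω := by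
  rcases t.2.1.eq_or_lt with ht | ht
  · have hs : (s : ℝ) = 0 := le_antisymm ((show (s : ℝ) ≤ t from hst).trans ht.ge) s.2.1
    refine Eventually.of_forall fun ω y hy => ?_
    rw [hX.eq_cone hs, ← hY.eq_cone ht.symm ω, Metric.infEDist_zero_of_mem hy]
    exact zero_le
  · refine (hY.isSetIntegral ht).ae_subset hℱ hF
      (fun ω => isClosed_le Metric.continuous_infEDist continuous_const) ?_
    rintro _ ⟨φ, hφ, rfl⟩
    filter_upwards [ae_integrable_of_mem_processSelectors hφ,
      ae_ae_mem_of_mem_processSelectors hφ, hX.ae_setIntegral_add_mem hℱ hC hF hφ] with ω h1 h2 h3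
    change Metric.infEDist _ _ ≤ _
    rw [setIntegral_Iic_eq_add h1 hst]
    set a := ∫ r in Set.Iic s, φ r ω ∂(timeMeasure T)
    set b := ∫ r in Set.Ioc s t, φ r ω ∂(timeMeasure T)
    calc Metric.infEDist (a + b) (X ω) ≤ Metric.infEDist (a + b) ((a + ·) '' C) :=
          Metric.infEDist_anti (by rintro _ ⟨c, hc, rfl⟩; exact h3 c hc)
      _ = Metric.infEDist b C := Metric.infEDist_image (isometry_add_left a)
      _ ≤ ∫⁻ r in Set.Ioc s t, Metric.infEDist (φ r ω) C ∂(timeMeasure T) :=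
          hC.infEDist_integral_le h1.integrableOn
      _ ≤ hausdorffIntegral F C s t ω := by
          refine lintegral_mono_ae (ae_restrict_of_ae ?_)
          filter_upwards [h2] with r hr
          exact Metric.infEDist_le_hausdorffEDist_of_mem hr

theorem IsIntegralVersion.ae_infEDist_add_le (hℱ : CompleteFiltration P ℱ)
    (hF : MemL2CF P ℱ C F) (hst : s ≤ t) (ht : 0 < (t : ℝ))
    (hY : IsIntegralVersion P ℱ C F t Y) (hφ : φ ∈ processSelectors P ℱ F) {c : Euc d}
    (hc : c ∈ C) :
    ∀ᵐ ω ∂P, Metric.infEDist (∫ r in Set.Iic s, φ r ω ∂(timeMeasure T) + ((t : ℝ) - s) • c) (Y ω) ≤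
      hausdorffIntegral F C s t ω := by
  have h : ∀ n : ℕ, ∀ᵐ ω ∂P,
      Metric.infEDist (∫ r in Set.Iic s, φ r ω ∂(timeMeasure T) + ((t : ℝ) - s) • c) (Y ω) ≤
      hausdorffIntegral F C s t ω +
        ENNReal.ofReal (1 / ((n : ℝ) + 1)) * timeMeasure T Set.univ := by
    intro n
    obtain ⟨ψ, hψ, hψd⟩ := exists_processSelectors_near hF hφ hst hc
      (show (0 : ℝ) < 1 / ((n : ℝ) + 1) by positivity)
    filter_upwards [hψd, (integralsOfSelectors_subset_selectors hℱ (hY.isSetIntegral ht)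
      ⟨ψ, hψ, rfl⟩).2] with ω h1 h2
    exact (Metric.infEDist_le_edist_of_mem h2).trans h1
  filter_upwards [ae_all_iff.2 h] with ω hω
  exact le_of_forall_le_add_ofReal (measure_ne_top _ _) hω

theorem IsIntegralVersion.ae_infEDist_le_of_mem_left (hℱ : CompleteFiltration P ℱ)
    (hC : IsGeneratingCone C)
    (hF : MemL2CF P ℱ C F) (hst : s ≤ t) (hX : IsIntegralVersion P ℱ C F s X)
    (hY : IsIntegralVersion P ℱ C F t Y) :
    ∀ᵐ ω ∂P, ∀ x ∈ X ω, Metric.infEDist x (Y ω) ≤ hausdorffIntegral F C s t ω := by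
  rcases t.2.1.eq_or_lt with ht | ht
  · have hs : (s : ℝ) = 0 := le_antisymm ((show (s : ℝ) ≤ t from hst).trans ht.ge) s.2.1
    refine Eventually.of_forall fun ω x hx => ?_
    rw [hY.eq_cone ht.symm, ← hX.eq_cone hs ω, Metric.infEDist_zero_of_mem hx]
    exact zero_le
  have hcl : ∀ ω, IsClosed {x | Metric.infEDist x (Y ω) ≤ hausdorffIntegral F C s t ω} :=
    fun ω => isClosed_le Metric.continuous_infEDist continuous_const
  rcases s.2.1.eq_or_lt with hs | hs
  -- At s = 0 the points to approximate are those of `C`: the direction c/t over [0, t] produces c,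
  -- and the integral of `φ` up to 0 vanishes. For s > 0 the direction 0 suffices.
  · obtain ⟨D, hDC, hD, hCD⟩ := (TopologicalSpace.IsSeparable.of_separableSpace
      C).exists_countable_dense_subset
    obtain ⟨φ, hφ⟩ := hF.selectors_nonempty
    have h : ∀ c ∈ D, ∀ᵐ ω ∂P, Metric.infEDist c (Y ω) ≤ hausdorffIntegral F C s t ω := by
      intro c hc
      filter_upwards [hY.ae_infEDist_add_le hℱ hF hst ht hφ
        (hC.smul_mem _ (inv_pos.2 ht) c (hDC hc))] with ω hω
      rwa [setIntegral_Iic_of_eq_zero hs.symm, ← hs, sub_zero, zero_add,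
        smul_inv_smul₀ ht.ne'] at hω
    filter_upwards [(ae_ball_iff hD).2 h] with ω hω x hx
    rw [hX.eq_cone hs.symm] at hx
    exact closure_minimal (fun c hc => hω c hc) (hcl ω) (hCD hx)
  · refine (hX.isSetIntegral hs).ae_subset hℱ hF hcl ?_
    rintro _ ⟨φ, hφ, rfl⟩
    filter_upwards [hY.ae_infEDist_add_le hℱ hF hst ht hφ hC.zero_mem] with ω hω
    rwa [smul_zero, add_zero] at hω

theorem IsIntegralVersion.ae_hausdorffEDist_le (hℱ : CompleteFiltration P ℱ)
    (hC : IsGeneratingCone C) (hF : MemL2CF P ℱ C F) (hst : s ≤ t)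
    (hX : IsIntegralVersion P ℱ C F s X) (hY : IsIntegralVersion P ℱ C F t Y) :
    ∀ᵐ ω ∂P, Metric.hausdorffEDist (X ω) (Y ω) ≤ hausdorffIntegral F C s t ω := by
  filter_upwards [hX.ae_infEDist_le_of_mem_right hℱ hC hF hst hY,
    hX.ae_infEDist_le_of_mem_left hℱ hC hF hst hY]
    with ω h1 h2
  exact Metric.hausdorffEDist_le_of_infEDist h2 h1

end Processes

/-! ### Continuous extension from a dense set -/

section Continuity

/-- Extension of a map from a dense set to a continuous map, agreeing with the original map wherever
the modulus of continuity is controlled. -/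
theorem exists_continuous_eq_of_edist_le {α β : Type*} [PseudoMetricSpace α] [EMetricSpace β]
    [CompleteSpace β] {D : Set α} (hD : Dense D) {f : α → β} {R : α → α → ℝ≥0∞}
    (hR : ∀ ε, 0 < ε → ∃ δ, 0 < δ ∧ ∀ s t, edist s t < δ → R s t < ε)
    (hf : ∀ s ∈ D, ∀ t ∈ D, edist (f s) (f t) ≤ R s t) :
    ∃ g : α → β, Continuous g ∧ ∀ t, (∀ s ∈ D, edist (f s) (f t) ≤ R s t) → g t = f t := by
  have hun : UniformContinuous fun s : D => f s := by
    rw [EMetric.uniformContinuous_iff]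
    intro ε hε
    obtain ⟨δ, hδ, h⟩ := hR ε hε
    exact ⟨δ, hδ, fun {a b} hab => (hf a a.2 b b.2).trans_lt (h _ _ hab)⟩
  have hind : IsUniformInducing ((↑) : D → α) := isUniformInducing_val D
  have hdr : DenseRange ((↑) : D → α) := hD.denseRange_val
  have hc := (uniformContinuous_uniformly_extend hind hdr hun).continuous
  refine ⟨_, hc, fun t ht => ?_⟩
  have h1 := uniformly_extend_spec hind hdr hun t
  have : (comap ((↑) : D → α) (𝓝 t)).NeBot := hD.comap_val_nhds_neBot t
  refine tendsto_nhds_unique h1 ?_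
  rw [tendsto_iff_edist_tendsto_0]
  refine ENNReal.tendsto_nhds_zero.2 fun ε hε => ?_
  obtain ⟨δ, hδ, h⟩ := hR ε hε
  have hball : ∀ᶠ s : D in comap ((↑) : D → α) (𝓝 t), edist (s : α) t < δ :=
    tendsto_comap.eventually (Metric.eball_mem_nhds t hδ)
  filter_upwards [hball] with s hs
  exact (ht s s.2).trans (h _ _ hs).le

end Continuity

/-! ### Membership in 𝕃²_C and the continuous modification -/

section Integral

variable {Ω : Type*} {mΩ : MeasurableSpace Ω} {d : ℕ} {T : ℝ}
  {P : Measure Ω} {ℱ : Filtration (Set.Icc (0 : ℝ) T) mΩ}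
  {C : Set (Euc d)} {F : Set.Icc (0 : ℝ) T → Ω → Set (Euc d)}

theorem measurable_hausdorffEDist_process (hF : MemL2CF P ℱ C F) :
    Measurable fun p : Set.Icc (0 : ℝ) T × Ω => Metric.hausdorffEDist (F p.1 p.2) C :=
  hF.nonAnticipative.1.measurable_hausdorffEDist C

theorem IsIntegralVersion.cone {t : Set.Icc (0 : ℝ) T} (ht : (t : ℝ) = 0) :
    IsIntegralVersion P ℱ C F t fun _ => C :=
  ⟨fun h => absurd ht h.ne', fun _ _ => rfl⟩

theorem IsSetIntegral.congr_ae (hℱ : CompleteFiltration P ℱ) {t : Set.Icc (0 : ℝ) T}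
    {I J : Ω → Set (Euc d)} (hI : IsSetIntegral P ℱ F t I) (hne : ∀ ω, (J ω).Nonempty)
    (hcl : ∀ ω, IsClosed (J ω)) (h : I =ᵐ[P] J) : IsSetIntegral P ℱ F t J :=
  ⟨hI.1.congr_ae (hℱ t) hne hcl h, (selectors_congr h).symm.trans hI.2⟩

theorem lintegral_sq_lintegral_hausdorffEDist_lt_top (hF : MemL2CF P ℱ C F) :
    ∫⁻ ω, (∫⁻ r, Metric.hausdorffEDist (F r ω) C ∂(timeMeasure T)) ^ 2 ∂P < ∞ := by
  calc ∫⁻ ω, (∫⁻ r, Metric.hausdorffEDist (F r ω) C ∂(timeMeasure T)) ^ 2 ∂P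
      ≤ ∫⁻ ω, timeMeasure T Set.univ * ∫⁻ r, hsq (F r ω) C ∂(timeMeasure T) ∂P :=
        lintegral_mono fun ω => sq_lintegral_le
          ((measurable_hausdorffEDist_process hF).comp measurable_prodMk_right).aemeasurable
    _ = timeMeasure T Set.univ * ∫⁻ ω, ∫⁻ r, hsq (F r ω) C ∂(timeMeasure T) ∂P :=
        lintegral_const_mul' _ _ (measure_ne_top _ _)
    _ < ∞ := ENNReal.mul_lt_top (measure_lt_top _ _) hF.sq_integrable

theorem ae_lintegral_hausdorffEDist_lt_top (hF : MemL2CF P ℱ C F) :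
    ∀ᵐ ω ∂P, ∫⁻ r, Metric.hausdorffEDist (F r ω) C ∂(timeMeasure T) < ∞ := by
  filter_upwards [ae_lt_top
    ((measurable_hausdorffEDist_process hF).lintegral_prod_left'.pow_const 2)
    (lintegral_sq_lintegral_hausdorffEDist_lt_top hF).ne] with ω hω
  exact (ENNReal.pow_lt_top_iff.1 hω).resolve_right (by norm_num)

theorem hausdorffIntegral_le (s t : Set.Icc (0 : ℝ) T) (ω : Ω) :
    hausdorffIntegral F C s t ω ≤ ∫⁻ r, Metric.hausdorffEDist (F r ω) C ∂(timeMeasure T) :=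
  setLIntegral_le_lintegral _ _

variable [IsProbabilityMeasure P]

theorem IsSetIntegral.memL2C (hℱ : CompleteFiltration P ℱ) (hC : IsGeneratingCone C)
    (hF : MemL2CF P ℱ C F) {t : Set.Icc (0 : ℝ) T} (ht : 0 < (t : ℝ)) {I : Ω → Set (Euc d)}
    (hI : IsSetIntegral P ℱ F t I) : MemL2C P (ℱ t) C I := by
  -- Comparing with time zero, where the process equals `C`, turns the increment estimate into a
  -- bound on h(I, C).
  let z : Set.Icc (0 : ℝ) T := ⟨0, le_rfl, t.2.1.trans t.2.2⟩
  have hd : ∀ᵐ ω ∂P, Metric.hausdorffEDist (I ω) C ≤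
      ∫⁻ r, Metric.hausdorffEDist (F r ω) C ∂(timeMeasure T) := by
    have hz : IsIntegralVersion P ℱ C F z fun _ => C := IsIntegralVersion.cone rfl
    filter_upwards [hz.ae_hausdorffEDist_le hℱ hC hF (show z ≤ t from t.2.1)
      ⟨fun _ => hI, fun h => absurd h ht.ne'⟩] with ω hω
    rw [Metric.hausdorffEDist_comm]
    exact hω.trans (hausdorffIntegral_le _ _ _)
  refine ⟨hI.1, ?_, ?_⟩
  · filter_upwards [hd, ae_lintegral_hausdorffEDist_lt_top hF, hI.ae_add_mem hℱ hF ht hC]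
      with ω h1 h2 h3
    refine ⟨hI.1.nonempty ω, hI.1.isClosed ω, subset_antisymm ?_ ?_, h1.trans_lt h2⟩
    · intro x hx
      exact subset_closure ⟨x, hx, 0, hC.zero_mem, add_zero x⟩
    · refine closure_minimal ?_ (hI.1.isClosed ω)
      rintro _ ⟨x, hx, c, hc, rfl⟩
      exact h3 c hc x hx
  · refine lt_of_le_of_lt (lintegral_mono_ae ?_) (lintegral_sq_lintegral_hausdorffEDist_lt_top hF)
    filter_upwards [hd] with ω hω
    exact pow_le_pow_left₀ zero_le hω 2

theorem exists_isSetIntegral (hℱ : CompleteFiltration P ℱ) (hF : MemL2CF P ℱ C F)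
    (t : Set.Icc (0 : ℝ) T) : ∃ I : Ω → Set (Euc d), IsSetIntegral P ℱ F t I :=
  exists_selectors_eq_closedDec (ℱ.le t) (integralsOfSelectors_subset_L2 hℱ t)
    (integralsOfSelectors_nonempty hF t)

theorem IsSetIntegral.ae_eq (hℱ : CompleteFiltration P ℱ) (hF : MemL2CF P ℱ C F)
    {t : Set.Icc (0 : ℝ) T} {I J : Ω → Set (Euc d)} (hI : IsSetIntegral P ℱ F t I)
    (hJ : IsSetIntegral P ℱ F t J) : I =ᵐ[P] J :=
  hI.1.ae_eq_of_selectors_eq (ℱ.le t) hJ.1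
    ((integralsOfSelectors_nonempty hF t).mono (integralsOfSelectors_subset_selectors hℱ hI))
    (hI.2.trans hJ.2.symm)

/-- Absolute continuity of the integral, since the interval between s and t has measure |s - t|. -/
theorem hausdorffIntegral_modulus {ω : Ω}
    (hω : ∫⁻ r, Metric.hausdorffEDist (F r ω) C ∂(timeMeasure T) < ∞) {ε : ℝ≥0∞} (hε : 0 < ε) :
    ∃ δ, 0 < δ ∧ ∀ s t : Set.Icc (0 : ℝ) T, edist s t < δ →
      hausdorffIntegral F C (min s t) (max s t) ω < ε := by
  obtain ⟨δ, hδ, h⟩ := exists_pos_setLIntegral_lt_of_measure_lt hω.ne hε.ne'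
  refine ⟨δ, hδ, fun s t hst => h _ (lt_of_eq_of_lt ?_ hst)⟩
  rw [← ofReal_measureReal, timeMeasure_real_Ioc min_le_max, edist_dist, Subtype.dist_eq,
    Real.dist_eq]
  congr 1
  rcases le_total s t with hle | hle
  · rw [max_eq_right hle, min_eq_left hle, abs_sub_comm,
      abs_of_nonneg (sub_nonneg.2 (show (s : ℝ) ≤ t from hle))]
  · rw [max_eq_left hle, min_eq_right hle,
      abs_of_nonneg (sub_nonneg.2 (show (t : ℝ) ≤ s from hle))]

/-- The set-valued integral process has a modification with Hausdorff-continuous paths. -/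
theorem exists_hausdorffContinuous_modification (hT : 0 < T) (hℱ : CompleteFiltration P ℱ)
    (hC : IsGeneratingCone C) (hF : MemL2CF P ℱ C F) {X : Set.Icc (0 : ℝ) T → Ω → Set (Euc d)}
    (hX : ∀ t, IsIntegralVersion P ℱ C F t (X t)) :
    ∃ Y : Set.Icc (0 : ℝ) T → Ω → Set (Euc d), (∀ t, Y t =ᵐ[P] X t) ∧
      (∀ t ω, (Y t ω).Nonempty) ∧ (∀ t ω, IsClosed (Y t ω)) ∧
      (∀ t : Set.Icc (0 : ℝ) T, (t : ℝ) = 0 → ∀ ω, Y t ω = C) ∧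
      ∀ᵐ ω ∂P, HausdorffContinuous fun t => Y t ω := by
  classical
  have hXne : ∀ t ω, (X t ω).Nonempty ∧ IsClosed (X t ω) := by
    intro t ω
    rcases t.2.1.eq_or_lt with ht | ht
    · rw [(hX t).eq_cone ht.symm]
      exact ⟨hC.nonempty, hC.isClosed⟩
    · have h := ((hX t).isSetIntegral ht).1
      exact ⟨h.nonempty ω, h.isClosed ω⟩
  -- The closed sets form a complete extended metric space under h, as the extension requires.
  let K : Ω → Set.Icc (0 : ℝ) T → TopologicalSpace.Closeds (Euc d) :=
    fun ω t => ⟨X t ω, (hXne t ω).2⟩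
  let R : Ω → Set.Icc (0 : ℝ) T → Set.Icc (0 : ℝ) T → ℝ≥0∞ := fun ω s t =>
    hausdorffIntegral F C (min s t) (max s t) ω
  let z : Set.Icc (0 : ℝ) T := ⟨0, le_rfl, hT.le⟩
  obtain ⟨D, hDc, hDd⟩ := TopologicalSpace.exists_countable_dense (Set.Icc (0 : ℝ) T)
  have hpair : ∀ s t, ∀ᵐ ω ∂P, edist (K ω s) (K ω t) ≤ R ω s t := by
    intro s t
    rcases le_total s t with h | h
    · filter_upwards [(hX s).ae_hausdorffEDist_le hℱ hC hF h (hX t)] with ω hω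
      simp only [R, min_eq_left h, max_eq_right h]
      exact hω
    · filter_upwards [(hX t).ae_hausdorffEDist_le hℱ hC hF h (hX s)] with ω hω
      rw [edist_comm]
      simp only [R, min_eq_right h, max_eq_left h]
      exact hω
  have hDpair : ∀ t, ∀ᵐ ω ∂P, ∀ s ∈ D, edist (K ω s) (K ω t) ≤ R ω s t := fun t =>
    (ae_ball_iff hDc).2 fun s _ => hpair s t
  -- The last clause forces the extension to equal `C` at time zero on every good path, not just
  -- almost surely.
  let good : Ω → Prop := fun ω =>
    ∫⁻ r, Metric.hausdorffEDist (F r ω) C ∂(timeMeasure T) < ∞ ∧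
      (∀ t ∈ D, ∀ s ∈ D, edist (K ω s) (K ω t) ≤ R ω s t) ∧
      ∀ s ∈ D, edist (K ω s) (K ω z) ≤ R ω s z
  have hgood : ∀ᵐ ω ∂P, good ω := by
    filter_upwards [ae_lintegral_hausdorffEDist_lt_top hF, (ae_ball_iff hDc).2 fun t _ => hDpair t,
      hDpair z] with ω h1 h2 h3
    exact ⟨h1, h2, h3⟩
  have hex : ∀ ω, good ω → ∃ g : Set.Icc (0 : ℝ) T → TopologicalSpace.Closeds (Euc d),
      Continuous g ∧ ∀ t, (∀ s ∈ D, edist (K ω s) (K ω t) ≤ R ω s t) → g t = K ω t :=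
    fun ω hω => exists_continuous_eq_of_edist_le hDd
      (fun ε hε => hausdorffIntegral_modulus hω.1 hε) fun s hs t ht => hω.2.1 t ht s hs
  choose g hgc hgK using hex
  refine ⟨fun t ω => if h : good ω then g ω h t else C, fun t => ?_, fun t ω => ?_, fun t ω => ?_,
    fun t ht ω => ?_, ?_⟩
  · filter_upwards [hgood, hDpair t] with ω h1 h2
    rw [dif_pos h1, hgK ω h1 t h2]
    rfl
  · dsimp only
    split_ifs with h
    -- `Closeds` contains the empty set, which is at infinite distance from nonempty sets. Finite
    -- distance to some nonempty X s, s ∈ D, excludes it.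
    · have hnear := (hgc ω h).tendsto t (Metric.eball_mem_nhds _ one_pos)
      obtain ⟨s, hs, hsD⟩ := mem_closure_iff_nhds.1 (hDd t) _ hnear
      have hs' : edist (g ω h s) (g ω h t) < 1 := hs
      rw [hgK ω h s (h.2.1 s hsD)] at hs'
      exact Metric.nonempty_of_hausdorffEDist_ne_top (hXne s ω).1
        (ne_top_of_lt (show Metric.hausdorffEDist (X s ω) (g ω h t) < 1 from hs'))
    · exact hC.nonempty
  · dsimp only
    split_ifs with h
    · exact (g ω h t).isClosed
    · exact hC.isClosed
  · have htz : t = z := Subtype.ext ht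
    dsimp only
    split_ifs with h
    · rw [htz, hgK ω h z h.2.2]
      exact (hX z).eq_cone rfl ω
    · rfl
  · filter_upwards [hgood] with ω h t
    simp only [dif_pos h]
    exact tendsto_iff_edist_tendsto_0.1 ((hgc ω h).tendsto t)

end Integral

end SetInt

theorem proposition4p6 {Ω : Type*} [mΩ : MeasurableSpace Ω] (P : Measure Ω)
    [IsProbabilityMeasure P] {d : ℕ} {T : ℝ} (hT : 0 < T)
    (ℱ : Filtration (Set.Icc (0 : ℝ) T) mΩ) (hℱ : SetInt.CompleteFiltration P ℱ)
    (C : Set (SetInt.Euc d)) (hC : SetInt.IsGeneratingCone C)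
    (F : Set.Icc (0 : ℝ) T → Ω → Set (SetInt.Euc d)) (hF : SetInt.MemL2CF P ℱ C F) :
    -- for `t > 0` the integral exists and is unique up to null sets
    (∀ t : Set.Icc (0 : ℝ) T, 0 < (t : ℝ) →
      ∃ I : Ω → Set (SetInt.Euc d), SetInt.IsSetIntegral P ℱ F t I ∧
        ∀ I' : Ω → Set (SetInt.Euc d), SetInt.IsSetIntegral P ℱ F t I' → I' =ᵐ[P] I) ∧
    -- it belongs to `𝕃²_C(Ω, 𝓕_t)`
    (∀ t : Set.Icc (0 : ℝ) T, 0 < (t : ℝ) →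
      ∀ I : Ω → Set (SetInt.Euc d), SetInt.IsSetIntegral P ℱ F t I →
        SetInt.MemL2C P (ℱ t) C I) ∧
    -- the integral process, with value `C` at time `0`, has a.s. Hausdorff continuous paths
    -- (up to the choice, for each `t`, of a version of the integral)
    (∀ X : Set.Icc (0 : ℝ) T → Ω → Set (SetInt.Euc d),
      (∀ t : Set.Icc (0 : ℝ) T, 0 < (t : ℝ) → SetInt.IsSetIntegral P ℱ F t (X t)) →
      ∃ Y : Set.Icc (0 : ℝ) T → Ω → Set (SetInt.Euc d),
        (∀ t : Set.Icc (0 : ℝ) T, 0 < (t : ℝ) →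
          SetInt.IsSetIntegral P ℱ F t (Y t) ∧ Y t =ᵐ[P] X t) ∧
        (∀ t : Set.Icc (0 : ℝ) T, (t : ℝ) = 0 → ∀ ω, Y t ω = C) ∧
        ∀ᵐ ω ∂P, SetInt.HausdorffContinuous (fun t => Y t ω)) := by

  refine ⟨fun t _ => ?_, fun t ht I hI => hI.memL2C hℱ hC hF ht, fun X hX => ?_⟩
  · obtain ⟨I, hI⟩ := SetInt.exists_isSetIntegral hℱ hF t
    exact ⟨I, hI, fun I' hI' => hI'.ae_eq hℱ hF hI⟩
  · classical
    obtain ⟨Y, hYX, hne, hcl, hY0, hYc⟩ := SetInt.exists_hausdorffContinuous_modification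
      -- The given family is unconstrained at time zero, so its value there is replaced by `C`.
      (X := fun t => if 0 < (t : ℝ) then X t else fun _ => C) hT hℱ hC hF fun t => by
        refine ⟨fun ht => ?_, fun ht ω => ?_⟩
        · rw [if_pos ht]
          exact hX t ht
        · rw [if_neg ht.not_gt]
    refine ⟨Y, fun t ht => ?_, hY0, hYc⟩
    have h : Y t =ᵐ[P] X t := by simpa only [if_pos ht] using hYX t
    exact ⟨(hX t ht).congr_ae hℱ (hne t) (hcl t) h.symm, h⟩
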